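/- Composition is written in diagrammatic order and all categories are small (relative to a fixed universe). A \emph{restriction category} is a category $\mathbb X$ with an assignment $f\colon A\to B\ \mapsto\ \bar f\colon A\to A$ such that $\bar f f=f$; $\bar f\bar g=\bar g\bar f$ and $\bar g\bar f=\overline{\bar g f}$ for $f\colon A\to B$, $g\colon A\to C$; and $f\bar g=\overline{fg}\,f$ for $f\colon A\to B$, $g\colon B\to C$. A morphism $f$ is \emph{total} if $\bar f=\mathrm{id}$. The restriction category is \emph{inverse} if for every $f\colon A\to B$ there is $f^\circ\colon B\to A$ with $ff^\circ=\bar f$ and $f^\circ f=\overline{f^\circ}$. A \emph{restriction functor} is a functor with $F(\bar f)=\overline{F(f)}$. A \emph{restriction natural transformation} $F\Rightarrow G$ is a family of total morphisms $\varphi_A\colon FA\to GA$ with $F(f)\varphi_B=F(\bar f)\varphi_A G(f)$ for all $f\colon A\to B$. Inverse restriction categories, restriction functors and restriction natural transformations form the 2-category $\mathsf{invRCat}_{\mathsf{lax}}$. A \emph{local category} is a category $\mathbb C$ with, for each object $M$, an object $\mathsf LM$ and a monomorphism $\eta_M\colon M\to\mathsf LM$ such that $\mathsf L\mathsf LM=\mathsf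 LM$, $\eta_{\mathsf LM}=\mathrm{id}$, and for all $f\colon N\to\mathsf LM$ there is a pullback of $\eta_M$ along $f$, with vertex $P$ and projection $m\colon P\to N$, such that $\mathsf LP=\mathsf LN$ and $m\eta_N=\eta_P$. One writes $V\le B$ if $\mathsf LV=\mathsf LB$ and there is a (necessarily unique) $m\colon V\to B$ with $m\eta_B=\eta_V$, called the canonical inclusion. A local category is \emph{inverse} if every morphism $f\colon A\to B$ is a \emph{local isomorphism}: there are $V\le B$ and an isomorphism $g\colon A\to V$ with $gm=f$, where $m\colon V\to B$ is the canonical inclusion. A \emph{local functor} is a functor with $F\mathsf LM=\mathsf LFM$ and $F\eta_M=\eta_{FM}$ that preserves the pullbacks of $\eta_N$ along all morphisms $M\to\mathsf LN$. Inverse local categories, local functors and all natural transformations between them form the 2-category $\mathsf{invLCat}_{\mathsf{lax}}$. \textbf{Theorem.} There is a 2-equivalence $\mathsf{invRCat}_{\mathsf{lax}}\simeq\mathsf{invLCat}_{\mathsf{lax}}$ in the following sense. There are strict 2-functors $\mathscr L\colon\mathsf{invRCat}_{\mathsf{lax}}\to\mathsf{invLCat}_{\mathsf{lax}}$ and $\mathscr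 R\colon\mathsf{invLCat}_{\mathsf{lax}}\to\mathsf{invRCat}_{\mathsf{lax}}$ and (strictly) 2-natural transformations $N\colon\mathrm{id}\Rightarrow\mathscr R\mathscr L$ and $E\colon\mathrm{id}\Rightarrow\mathscr L\mathscr R$ such that every component of $N$ is an isomorphism and every component of $E$ is an equivalence in the respective 2-category. Moreover, in every local category $\mathscr L[\mathbb X]$ the relation $\le$ is antisymmetric ($M\le N\le M$ implies $M=N$), and the component $E_{\mathbb C}$ is an isomorphism whenever $\le$ is antisymmetric on the objects of $\mathbb C$. In an inverse local category every morphism $f\colon A\to B$ factors as an isomorphism $A\cong V$ onto some $V\le B$ followed by the canonical inclusion $V\to B$. -/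

import Mathlib

open CategoryTheory Bicategory

universe u

namespace Partiality

/-! ## Restriction categories -/

section Restriction

universe v₁ u₁ v₂ u₂ v₃ u₃

/-- A restriction structure on a category. Composition is written in diagrammatic order. -/
class RestrictionStructure (X : Type u₁) [Category.{v₁} X] where
  /-- the restriction idempotent of a morphism -/
  rest : ∀ {A B : X}, (A ⟶ B) → (A ⟶ A)
  rest_comp_self : ∀ {A B : X} (f : A ⟶ B), rest f ≫ f = f
  rest_comm : ∀ {A B C : X} (f : A ⟶ B) (g : A ⟶ C), rest f ≫ rest g = rest g ≫ rest f
  rest_rest_comp : ∀ {A B C : X} (f : A ⟶ B) (g : A ⟶ C), rest g ≫ rest f = rest (rest g ≫ f)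
  comp_rest : ∀ {A B C : X} (f : A ⟶ B) (g : B ⟶ C), f ≫ rest g = rest (f ≫ g) ≫ f

open RestrictionStructure

/-- A morphism is total when its restriction idempotent is the identity. -/
def IsTotal {X : Type u₁} [Category.{v₁} X] [RestrictionStructure X] {A B : X} (f : A ⟶ B) :
    Prop :=
  rest f = 𝟙 A

/-- A restriction isomorphism: a morphism with a partial inverse. -/
def IsRestrictionIso {X : Type u₁} [Category.{v₁} X] [RestrictionStructure X] {A B : X}
    (f : A ⟶ B) : Prop :=
  ∃ g : B ⟶ A, f ≫ g = rest f ∧ g ≫ f = rest g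

section
variable {X : Type u₁} [Category.{v₁} X] [RestrictionStructure X]

theorem rest_id (A : X) : rest (𝟙 A) = 𝟙 A := by
  have h := rest_comp_self (𝟙 A)
  rwa [Category.comp_id] at h

theorem rest_rest {A B : X} (f : A ⟶ B) : rest (rest f) = rest f := by
  have h := rest_rest_comp (𝟙 A) f
  rw [rest_id, Category.comp_id] at h
  exact h.symm

theorem IsTotal.id (A : X) : IsTotal (𝟙 A) := rest_id A

theorem IsTotal.comp {A B C : X} {f : A ⟶ B} {g : B ⟶ C} (hf : IsTotal f) (hg : IsTotal g) :
    IsTotal (f ≫ g) := by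
  have h := comp_rest f g
  rw [hg, Category.comp_id] at h
  have h2 := rest_rest_comp f (f ≫ g)
  rw [← h, hf, Category.comp_id] at h2
  exact h2

end

variable (X : Type u₁) [Category.{v₁} X] [RestrictionStructure X]
  (Y : Type u₂) [Category.{v₂} Y] [RestrictionStructure Y]
  (Z : Type u₃) [Category.{v₃} Z] [RestrictionStructure Z]

/-- A restriction functor is a functor that preserves restriction idempotents. -/
structure RestrictionFunctor where
  /-- the underlying functor -/
  toFunctor : X ⥤ Y
  map_rest : ∀ {A B : X} (f : A ⟶ B), toFunctor.map (rest f) = rest (toFunctor.map f)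

namespace RestrictionFunctor

/-- The identity restriction functor. -/
def id : RestrictionFunctor X X := ⟨𝟭 X, fun _ => rfl⟩

variable {X Y Z}

/-- The composite of two restriction functors. -/
def comp (F : RestrictionFunctor X Y) (G : RestrictionFunctor Y Z) : RestrictionFunctor X Z where
  toFunctor := F.toFunctor ⋙ G.toFunctor
  map_rest f := by simp [F.map_rest, G.map_rest]

theorem isTotal_map (F : RestrictionFunctor X Y) {A B : X} {f : A ⟶ B} (hf : IsTotal f) :
    IsTotal (F.toFunctor.map f) := by
  unfold IsTotal at *
  rw [← F.map_rest, hf, F.toFunctor.map_id]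

end RestrictionFunctor

variable {X Y Z}

/-- A restriction natural transformation: a family of total morphisms that is natural
up to restriction to the domain of definition. -/
@[ext]
structure RestrictionNatTrans (F G : RestrictionFunctor X Y) where
  /-- the components -/
  app : ∀ A : X, F.toFunctor.obj A ⟶ G.toFunctor.obj A
  total : ∀ A : X, IsTotal (app A)
  naturality : ∀ {A B : X} (f : A ⟶ B),
    F.toFunctor.map f ≫ app B = F.toFunctor.map (rest f) ≫ app A ≫ G.toFunctor.map f

namespace RestrictionNatTrans

/-- The identity restriction natural transformation. -/
def id (F : RestrictionFunctor X Y) : RestrictionNatTrans F F where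
  app A := 𝟙 _
  total A := IsTotal.id _
  naturality f := by
    rw [Category.comp_id, Category.id_comp, ← F.toFunctor.map_comp, rest_comp_self]

/-- Vertical composition of restriction natural transformations. -/
def vcomp {F G H : RestrictionFunctor X Y} (φ : RestrictionNatTrans F G)
    (ψ : RestrictionNatTrans G H) : RestrictionNatTrans F H where
  app A := φ.app A ≫ ψ.app A
  total A := (φ.total A).comp (ψ.total A)
  naturality {A B} f := by
    have h := φ.naturality (rest f)
    rw [rest_rest] at h
    rw [← Category.assoc, φ.naturality f, Category.assoc, Category.assoc, ψ.naturality f,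
      Category.assoc, ← Category.assoc (φ.app A) (G.toFunctor.map (rest f)),
      ← Category.assoc (F.toFunctor.map (rest f)), ← h]
    simp only [Category.assoc]

/-- Whiskering on the left: the component at `A` is the component of `ψ` at `F A`. -/
def whiskerLeft (F : RestrictionFunctor X Y) {G H : RestrictionFunctor Y Z}
    (ψ : RestrictionNatTrans G H) : RestrictionNatTrans (F.comp G) (F.comp H) where
  app A := ψ.app (F.toFunctor.obj A)
  total A := ψ.total _
  naturality f := by
    have h := ψ.naturality (F.toFunctor.map f)
    rw [← F.map_rest] at h
    exact h

/-- Whiskering on the right: the component at `A` is `H` applied to the component of `φ`. -/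
def whiskerRight {F G : RestrictionFunctor X Y} (φ : RestrictionNatTrans F G)
    (H : RestrictionFunctor Y Z) : RestrictionNatTrans (F.comp H) (G.comp H) where
  app A := H.toFunctor.map (φ.app A)
  total A := H.isTotal_map (φ.total A)
  naturality f := by
    have h := congrArg H.toFunctor.map (φ.naturality f)
    simp only [Functor.map_comp] at h
    exact h

end RestrictionNatTrans

instance : Category (RestrictionFunctor X Y) where
  Hom F G := RestrictionNatTrans F G
  id F := RestrictionNatTrans.id F
  comp φ ψ := RestrictionNatTrans.vcomp φ ψ
  id_comp _ := RestrictionNatTrans.ext (funext fun _ => Category.id_comp _)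
  comp_id _ := RestrictionNatTrans.ext (funext fun _ => Category.comp_id _)
  assoc _ _ _ := RestrictionNatTrans.ext (funext fun _ => Category.assoc _ _ _)

end Restriction

/-- A small restriction category (an object of the 2-category below). -/
structure RCatLax where
  /-- the type of objects -/
  carrier : Type u
  [category : Category.{u} carrier]
  [restriction : RestrictionStructure carrier]

attribute [instance] RCatLax.category RCatLax.restriction

/-- The 2-category of small restriction categories, restriction functors and restriction natural
transformations. The associators and unitors have identity components. -/
instance RCatLax.bicategory : Bicategory RCatLax.{u} where
  Hom X Y := RestrictionFunctor X.carrier Y.carrier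
  id X := RestrictionFunctor.id X.carrier
  comp F G := F.comp G
  homCategory X Y := inferInstanceAs (Category (RestrictionFunctor X.carrier Y.carrier))
  whiskerLeft F _ _ ψ := RestrictionNatTrans.whiskerLeft F ψ
  whiskerRight φ H := RestrictionNatTrans.whiskerRight φ H
  associator F G H := Iso.refl (C := RestrictionFunctor _ _) ((F.comp G).comp H)
  leftUnitor F := Iso.refl (C := RestrictionFunctor _ _) F
  rightUnitor F := Iso.refl (C := RestrictionFunctor _ _) F
  whiskerLeft_id F G := RestrictionNatTrans.ext (funext fun _ => rfl)
  whiskerLeft_comp F _ _ _ φ ψ := RestrictionNatTrans.ext (funext fun _ => rfl)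
  id_whiskerLeft φ := RestrictionNatTrans.ext (funext fun _ => by
    exact ((Category.id_comp _).trans (Category.comp_id _)).symm)
  comp_whiskerLeft F G _ _ φ := RestrictionNatTrans.ext (funext fun _ => by
    exact ((Category.id_comp _).trans (Category.comp_id _)).symm)
  id_whiskerRight F G := RestrictionNatTrans.ext (funext fun _ => G.toFunctor.map_id _)
  comp_whiskerRight φ ψ H := RestrictionNatTrans.ext (funext fun _ => H.toFunctor.map_comp _ _)
  whiskerRight_id φ := RestrictionNatTrans.ext (funext fun _ => by
    exact ((Category.id_comp _).trans (Category.comp_id _)).symm)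
  whiskerRight_comp φ G H := RestrictionNatTrans.ext (funext fun _ => by
    exact ((Category.id_comp _).trans (Category.comp_id _)).symm)
  whisker_assoc F _ _ φ H := RestrictionNatTrans.ext (funext fun _ => by
    exact ((Category.id_comp _).trans (Category.comp_id _)).symm)
  whisker_exchange {_ _ _ F G H K} φ ψ := RestrictionNatTrans.ext (funext fun A => by
    have h := ψ.naturality (φ.app A)
    rw [φ.total A, H.toFunctor.map_id, Category.id_comp] at h
    exact h.symm)
  pentagon F G H K := RestrictionNatTrans.ext (funext fun A => by
    change K.toFunctor.map (𝟙 _) ≫ 𝟙 _ ≫ 𝟙 _ = 𝟙 _ ≫ 𝟙 _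
    rw [K.toFunctor.map_id, Category.id_comp])
  triangle F G := RestrictionNatTrans.ext (funext fun A => by
    change 𝟙 _ ≫ 𝟙 _ = G.toFunctor.map (𝟙 _)
    rw [G.toFunctor.map_id, Category.id_comp])

instance : Bicategory.Strict RCatLax.{u} where
  id_comp _ := rfl
  comp_id _ := rfl
  assoc _ _ _ := rfl
  leftUnitor_eqToIso _ := rfl
  rightUnitor_eqToIso _ := rfl
  associator_eqToIso _ _ _ := rfl

/-- An inverse restriction category: every morphism is a restriction isomorphism. -/
def RCatLax.IsInverse (X : RCatLax.{u}) : Prop :=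
  ∀ {A B : X.carrier} (f : A ⟶ B), IsRestrictionIso f

/-- The full 2-subcategory of `RCatLax` spanned by inverse restriction categories. -/
abbrev InvRCatLax :=
  InducedBicategory RCatLax.{u} (fun X : {X : RCatLax.{u} // X.IsInverse} => X.1)

/-! ## Local categories -/

section Local

universe v₁ u₁ v₂ u₂ v₃ u₃

/-- A local structure on a category: enlargements `L M` and maximal inclusions `η M : M ⟶ L M`.
In the last axiom the pullback of `η M` along `f` can be chosen such that its vertex `P` has the
same enlargement as `N` and its projection to `N` commutes with the maximal inclusions. -/
class LocalStructure (C : Type u₁) [Category.{v₁} C] where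
  /-- the enlargement of an object -/
  L : C → C
  /-- the maximal inclusion of an object -/
  η : ∀ M : C, M ⟶ L M
  L_L : ∀ M : C, L (L M) = L M
  η_L : ∀ M : C, η (L M) = eqToHom (L_L M).symm
  mono_η : ∀ M : C, Mono (η M)
  exists_pullback : ∀ {M N : C} (f : N ⟶ L M),
    ∃ (P : C) (p : P ⟶ M) (m : P ⟶ N) (h : L P = L N),
      IsPullback p m (η M) f ∧ m ≫ η N = η P ≫ eqToHom h

open LocalStructure

section
variable {C : Type u₁} [Category.{v₁} C] [LocalStructure C]

/-- `m : V ⟶ B` is the canonical inclusion of `V` into `B`: the objects have the same enlargement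
and `m` commutes with the maximal inclusions. -/
def IsInclusion {V B : C} (m : V ⟶ B) : Prop :=
  ∃ h : L V = L B, m ≫ η B = η V ≫ eqToHom h

/-- The relation `V ≤ B` on the objects of a local category. -/
def Below (V B : C) : Prop := ∃ m : V ⟶ B, IsInclusion m

/-- A local isomorphism: an isomorphism onto some `V ≤ B` followed by the inclusion. -/
def IsLocalIso {A B : C} (f : A ⟶ B) : Prop :=
  ∃ (V : C) (g : A ⟶ V) (m : V ⟶ B), IsInclusion m ∧ IsIso g ∧ g ≫ m = f

end

variable (C : Type u₁) [Category.{v₁} C] [LocalStructure C]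
  (D : Type u₂) [Category.{v₂} D] [LocalStructure D]
  (E : Type u₃) [Category.{v₃} E] [LocalStructure E]

/-- A local functor: a functor that preserves the local structure strictly and preserves the
pullbacks of the maximal inclusions. -/
structure LocalFunctor where
  /-- the underlying functor -/
  toFunctor : C ⥤ D
  obj_L : ∀ M : C, toFunctor.obj (L M) = L (toFunctor.obj M)
  map_η : ∀ M : C, toFunctor.map (η M) ≫ eqToHom (obj_L M) = η (toFunctor.obj M)
  map_isPullback : ∀ {M N P : C} (f : M ⟶ L N) (p : P ⟶ N) (m : P ⟶ M),
    IsPullback p m (η N) f →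
      IsPullback (toFunctor.map p) (toFunctor.map m) (toFunctor.map (η N)) (toFunctor.map f)

namespace LocalFunctor

/-- The identity local functor. -/
def id : LocalFunctor C C where
  toFunctor := 𝟭 C
  obj_L _ := rfl
  map_η _ := Category.comp_id _
  map_isPullback _ _ _ h := h

variable {C D E}

theorem map_isPullback' (F : LocalFunctor C D) {M N P K : C} (hK : K = L N) (a : N ⟶ K)
    (ha : a ≫ eqToHom hK = η N) (f : M ⟶ K) (p : P ⟶ N) (m : P ⟶ M) (h : IsPullback p m a f) :
    IsPullback (F.toFunctor.map p) (F.toFunctor.map m) (F.toFunctor.map a)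
      (F.toFunctor.map f) := by
  subst hK
  rw [eqToHom_refl, Category.comp_id] at ha
  subst ha
  exact F.map_isPullback f p m h

/-- The composite of two local functors. -/
def comp (F : LocalFunctor C D) (G : LocalFunctor D E) : LocalFunctor C E where
  toFunctor := F.toFunctor ⋙ G.toFunctor
  obj_L M := (congrArg G.toFunctor.obj (F.obj_L M)).trans (G.obj_L _)
  map_η M := by
    change G.toFunctor.map (F.toFunctor.map (η M)) ≫ _ = η (G.toFunctor.obj (F.toFunctor.obj M))
    rw [← G.map_η, ← F.map_η, Functor.map_comp, eqToHom_map, Category.assoc, eqToHom_trans]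
  map_isPullback f p m h :=
    G.map_isPullback' (F.obj_L _) _ (F.map_η _) _ _ _ (F.map_isPullback f p m h)

end LocalFunctor

variable {C D}

/-- A local natural transformation is a natural transformation of the underlying functors. -/
instance : Category (LocalFunctor C D) where
  Hom F G := F.toFunctor ⟶ G.toFunctor
  id F := 𝟙 F.toFunctor
  comp φ ψ := NatTrans.vcomp φ ψ
  id_comp _ := NatTrans.ext (funext fun _ => Category.id_comp _)
  comp_id _ := NatTrans.ext (funext fun _ => Category.comp_id _)
  assoc _ _ _ := NatTrans.ext (funext fun _ => Category.assoc _ _ _)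

end Local

/-- A small local category (an object of the 2-category below). -/
structure LCatLax where
  /-- the type of objects -/
  carrier : Type u
  [category : Category.{u} carrier]
  [localStructure : LocalStructure carrier]

attribute [instance] LCatLax.category LCatLax.localStructure

/-- The 2-category of small local categories, local functors and local natural transformations.
The associators and unitors have identity components. -/
instance LCatLax.bicategory : Bicategory LCatLax.{u} where
  Hom C D := LocalFunctor C.carrier D.carrier
  id C := LocalFunctor.id C.carrier
  comp F G := F.comp G
  homCategory C D := inferInstanceAs (Category (LocalFunctor C.carrier D.carrier))
  whiskerLeft F _ _ ψ := Functor.whiskerLeft F.toFunctor ψ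
  whiskerRight φ H := Functor.whiskerRight φ H.toFunctor
  associator F G H := Iso.refl (C := LocalFunctor _ _) ((F.comp G).comp H)
  leftUnitor F := Iso.refl (C := LocalFunctor _ _) F
  rightUnitor F := Iso.refl (C := LocalFunctor _ _) F
  whiskerLeft_id F G := NatTrans.ext (funext fun _ => rfl)
  whiskerLeft_comp F _ _ _ φ ψ := NatTrans.ext (funext fun _ => rfl)
  id_whiskerLeft φ := NatTrans.ext (funext fun _ => by
    exact ((Category.id_comp _).trans (Category.comp_id _)).symm)
  comp_whiskerLeft F G _ _ φ := NatTrans.ext (funext fun _ => by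
    exact ((Category.id_comp _).trans (Category.comp_id _)).symm)
  id_whiskerRight F G := NatTrans.ext (funext fun _ => G.toFunctor.map_id _)
  comp_whiskerRight φ ψ H := NatTrans.ext (funext fun _ => H.toFunctor.map_comp _ _)
  whiskerRight_id φ := NatTrans.ext (funext fun _ => by
    exact ((Category.id_comp _).trans (Category.comp_id _)).symm)
  whiskerRight_comp φ G H := NatTrans.ext (funext fun _ => by
    exact ((Category.id_comp _).trans (Category.comp_id _)).symm)
  whisker_assoc F _ _ φ H := NatTrans.ext (funext fun _ => by
    exact ((Category.id_comp _).trans (Category.comp_id _)).symm)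
  whisker_exchange φ ψ := NatTrans.ext (funext fun A =>
    (NatTrans.naturality ψ (NatTrans.app φ A)).symm)
  pentagon F G H K := NatTrans.ext (funext fun A => by
    change K.toFunctor.map (𝟙 _) ≫ 𝟙 _ ≫ 𝟙 _ = 𝟙 _ ≫ 𝟙 _
    rw [K.toFunctor.map_id, Category.id_comp])
  triangle F G := NatTrans.ext (funext fun A => by
    change 𝟙 _ ≫ 𝟙 _ = G.toFunctor.map (𝟙 _)
    rw [G.toFunctor.map_id, Category.id_comp])

instance : Bicategory.Strict LCatLax.{u} where
  id_comp _ := rfl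
  comp_id _ := rfl
  assoc _ _ _ := rfl
  leftUnitor_eqToIso _ := rfl
  rightUnitor_eqToIso _ := rfl
  associator_eqToIso _ _ _ := rfl

/-- An inverse local category: every morphism is a local isomorphism. -/
def LCatLax.IsInverse (C : LCatLax.{u}) : Prop :=
  ∀ {A B : C.carrier} (f : A ⟶ B), IsLocalIso f

/-- The relation `≤` on the objects of a local category is antisymmetric on the nose (in general
`M ≤ N` and `N ≤ M` only give an isomorphism `M ≅ N`). -/
def LCatLax.IsAntisymm (C : LCatLax.{u}) : Prop :=
  ∀ M N : C.carrier, Below M N → Below N M → M = N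

/-- The full 2-subcategory of `LCatLax` spanned by inverse local categories. -/
abbrev InvLCatLax :=
  InducedBicategory LCatLax.{u} (fun C : {C : LCatLax.{u} // C.IsInverse} => C.1)

/-! ## 2-equivalences -/

section TwoEquivalence

universe w₁ v₁ u₁ w₂ v₂ u₂

variable {B : Type u₁} [Bicategory.{w₁, v₁} B] {K : Type u₂} [Bicategory.{w₂, v₂} K]

/-- A (strictly) 2-natural transformation between 2-functors. -/
structure TwoNatTrans (F G : StrictPseudofunctor B K) where
  /-- the components -/
  app : ∀ X : B, F.obj X ⟶ G.obj X
  naturality : ∀ {X Y : B} (f : X ⟶ Y), F.map f ≫ app Y = app X ≫ G.map f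
  naturality₂ : ∀ {X Y : B} {f g : X ⟶ Y} (θ : f ⟶ g),
    F.map₂ θ ▷ app Y ≫ eqToHom (naturality g) = eqToHom (naturality f) ≫ app X ◁ G.map₂ θ

/-- A 1-cell is an isomorphism when it has a strict inverse. -/
def IsOneCellIso {X Y : K} (f : X ⟶ Y) : Prop :=
  ∃ g : Y ⟶ X, f ≫ g = 𝟙 X ∧ g ≫ f = 𝟙 Y

/-- A 1-cell is an equivalence when it has an inverse up to invertible 2-cells. -/
def IsOneCellEquivalence {X Y : K} (f : X ⟶ Y) : Prop :=
  ∃ g : Y ⟶ X, Nonempty (f ≫ g ≅ 𝟙 X) ∧ Nonempty (g ≫ f ≅ 𝟙 Y)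

variable (B K)

/-- A 2-equivalence between 2-categories: 2-functors in both directions together with 2-natural
transformations from the identities to the two composites all of whose components are
equivalences. -/
structure TwoEquivalence where
  /-- the 2-functor in the forward direction -/
  functor : StrictPseudofunctor B K
  /-- the 2-functor in the backward direction -/
  inverse : StrictPseudofunctor K B
  /-- the comparison on `B` -/
  unit : TwoNatTrans (StrictPseudofunctor.id B) (functor.comp inverse)
  /-- the comparison on `K` -/
  counit : TwoNatTrans (StrictPseudofunctor.id K) (inverse.comp functor)
  unit_equivalence : ∀ X : B, IsOneCellEquivalence (unit.app X)
  counit_equivalence : ∀ Y : K, IsOneCellEquivalence (counit.app Y)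

end TwoEquivalence

end Partiality

namespace Partiality

/-! ### From restriction categories to local categories. -/

section LocalOfRestriction

universe v₁ u₁ v₂ u₂ v₃ u₃

open RestrictionStructure

section
variable {X : Type u₁} [Category.{v₁} X] [RestrictionStructure X]

/-! A restriction idempotent `e` on `A` plays the role of a subobject of `A`. `LocObj X` turns these
into objects `(A, e)`; its morphisms are the maps with domain exactly `e` and image inside the
target idempotent, and enlarging replaces `e` by the identity. Conversely, a local category yields
partial maps between the objects with `L A = A`, given by spans whose left leg is an inclusion. A
span is recorded only through the relation it represents on generalized elements. Isomorphic spans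
then become equal and composition is relational, so the laws hold strictly with no chosen pullbacks;
pullbacks only show that composites are again represented.

Both round trips are fully faithful. For `X`, the objects fixed by `L` are the pairs `(A, 1)`, so
the comparison is bijective on objects and hence an isomorphism. For `C`, an object `M` goes to the
idempotent on `L M` cut out by `η M`. Every idempotent arises in this way (`exists_counitObj_eq`),
so choosing preimages gives an inverse up to isomorphism. Objects with the same image lie below each
other (`below_of_counitObj_eq`), so antisymmetry makes this inverse strict.

The inverse conditions match: a partial inverse `g` of `f` exhibits `rest g` as the image of `f`,
and a local isomorphism on the right leg of a span allows the span to be reversed. -/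

theorem rest_comp_rest {A B C : X} (f : A ⟶ B) (g : B ⟶ C) :
    rest (f ≫ rest g) = rest (f ≫ g) := by
  rw [comp_rest, ← rest_rest_comp, rest_comm, rest_rest_comp, ← Category.assoc, rest_comp_self]

theorem rest_comp_of_rest_comp_eq {A B C D : X} {f : A ⟶ B} {g : B ⟶ C} {k : B ⟶ D}
    (h : f ≫ rest k = f) (hg : rest g = rest k) : rest (f ≫ g) = rest f := by
  rw [← rest_comp_rest, hg, h]

end

variable (X : Type u₁) [Category.{v₁} X] [RestrictionStructure X]

/-- An object of the local category of a restriction category: an object together with a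
restriction idempotent on it. -/
@[ext]
structure LocObj where
  /-- the ambient object -/
  base : X
  /-- the restriction idempotent -/
  idem : base ⟶ base
  rest_idem : rest idem = idem

variable {X}

/-- A morphism of the local category of a restriction category: a morphism between the ambient
objects with the prescribed domain of definition and with image in the prescribed codomain. -/
@[ext]
structure LocHom (M N : LocObj X) where
  /-- the underlying morphism -/
  hom : M.base ⟶ N.base
  rest_hom : rest hom = M.idem
  comp_idem : hom ≫ N.idem = hom

theorem LocObj.idem_comp_idem (M : LocObj X) : M.idem ≫ M.idem = M.idem := by
  have h := rest_comp_self M.idem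
  rwa [M.rest_idem] at h

theorem LocHom.idem_comp {M N : LocObj X} (f : LocHom M N) : M.idem ≫ f.hom = f.hom := by
  rw [← f.rest_hom, rest_comp_self]

/-- The identity of `(A, e)` is `e`, not `𝟙 A`. A composite keeps the domain of its first factor
because that factor lands in the domain of the second. -/
instance : Category (LocObj X) where
  Hom M N := LocHom M N
  id M := ⟨M.idem, M.rest_idem, M.idem_comp_idem⟩
  comp {M N K} f g :=
    { hom := f.hom ≫ g.hom
      rest_hom := by
        rw [rest_comp_of_rest_comp_eq (k := N.idem) (by rw [N.rest_idem, f.comp_idem])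
          (by rw [g.rest_hom, N.rest_idem]), f.rest_hom]
      comp_idem := by rw [Category.assoc, g.comp_idem] }
  id_comp f := LocHom.ext f.idem_comp
  comp_id f := LocHom.ext f.comp_idem
  assoc _ _ _ := LocHom.ext (Category.assoc _ _ _)

namespace LocObj

@[ext]
theorem hom_ext {M N : LocObj X} {f g : M ⟶ N} (h : f.hom = g.hom) : f = g := LocHom.ext h

@[simp]
theorem comp_hom {M N K : LocObj X} (f : M ⟶ N) (g : N ⟶ K) : (f ≫ g).hom = f.hom ≫ g.hom := rfl

theorem eqToHom_hom {M N : LocObj X} (h : M = N) :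
    (eqToHom h).hom = M.idem ≫ eqToHom (congrArg LocObj.base h) := by
  subst h
  exact (Category.comp_id _).symm

theorem eq_iff {A : X} {e e' : A ⟶ A} {h : rest e = e} {h' : rest e' = e'} :
    (⟨A, e, h⟩ : LocObj X) = ⟨A, e', h'⟩ ↔ e = e' := by
  simp

/-- The identity idempotent on the ambient object. -/
abbrev total (A : X) : LocObj X := ⟨A, 𝟙 A, rest_id A⟩

/-- In a cone, the leg to `N` followed by `f` equals the leg to `M`, so it already lands in the
domain of `f ≫ M.idem`; the lift is this leg with a smaller codomain. The free idempotents `k` and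
`d` let the lemma apply also to the image of the square under a functor, where `F (𝟙 A) = 𝟙 (F A)`
is not definitional. -/
theorem isPullback_of_hom_eq {M N : LocObj X} {k : M.base ⟶ M.base} {hk : rest k = k}
    {d : N.base ⟶ N.base} {hd : rest d = d} (a : M ⟶ ⟨M.base, k, hk⟩) (ha : a.hom = M.idem)
    (f : N ⟶ ⟨M.base, k, hk⟩) (hdf : d = rest (f.hom ≫ M.idem))
    (p : (⟨N.base, d, hd⟩ : LocObj X) ⟶ M) (hp : p.hom = f.hom ≫ M.idem)
    (m : (⟨N.base, d, hd⟩ : LocObj X) ⟶ N) (hm : m.hom = d) : IsPullback p m a f := by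
  have hfd : f.hom ≫ M.idem = d ≫ f.hom := by
    have h := comp_rest f.hom M.idem
    rwa [M.rest_idem, ← hdf] at h
  have hw : p ≫ a = m ≫ f := hom_ext (by
    rw [comp_hom, comp_hom, hp, hm, ha, Category.assoc, M.idem_comp_idem, hfd])
  refine ⟨⟨hw⟩, ⟨Limits.PullbackCone.IsLimit.mk hw (fun s => ⟨s.snd.hom, s.snd.rest_hom, ?_⟩)
    (fun s => hom_ext ?_) (fun s => hom_ext ?_) (fun s l _ hl => hom_ext ?_)⟩⟩
  · have h := congrArg LocHom.hom s.condition
    rw [comp_hom, comp_hom, ha, s.fst.comp_idem] at h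
    change s.snd.hom ≫ d = s.snd.hom
    rw [hdf, comp_rest, ← Category.assoc, ← h, s.fst.comp_idem, s.fst.rest_hom, s.snd.idem_comp]
  · have h := congrArg LocHom.hom s.condition
    rw [comp_hom, comp_hom, ha, s.fst.comp_idem] at h
    rw [comp_hom, hp, ← Category.assoc]
    change (s.snd.hom ≫ f.hom) ≫ _ = _
    rw [← h, s.fst.comp_idem]
  · have h := congrArg LocHom.hom s.condition
    rw [comp_hom, comp_hom, ha, s.fst.comp_idem] at h
    rw [comp_hom, hm]
    change s.snd.hom ≫ d = s.snd.hom
    rw [hdf, comp_rest, ← Category.assoc, ← h, s.fst.comp_idem, s.fst.rest_hom, s.snd.idem_comp]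
  · have h := congrArg LocHom.hom hl
    rw [comp_hom, hm, l.comp_idem] at h
    exact h

/-- The maximal inclusion into the identity idempotent. -/
abbrev toTotal (M : LocObj X) : M ⟶ total M.base := ⟨M.idem, M.rest_idem, Category.comp_id _⟩

/-- The vertex of the pullback of a maximal inclusion. -/
abbrev pullbackObj {M N : LocObj X} (f : N ⟶ total M.base) : LocObj X :=
  ⟨N.base, rest (f.hom ≫ M.idem), rest_rest _⟩

/-- The projection to the smaller object in the pullback of a maximal inclusion. -/
abbrev pullbackFst {M N : LocObj X} (f : N ⟶ total M.base) : pullbackObj f ⟶ M :=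
  ⟨f.hom ≫ M.idem, rfl, by rw [Category.assoc, M.idem_comp_idem]⟩

/-- The inclusion of the vertex in the pullback of a maximal inclusion. -/
abbrev pullbackSnd {M N : LocObj X} (f : N ⟶ total M.base) : pullbackObj f ⟶ N where
  hom := rest (f.hom ≫ M.idem)
  rest_hom := rest_rest _
  comp_idem := by
    rw [← f.rest_hom, ← rest_comm, rest_rest_comp, ← Category.assoc, rest_comp_self]

instance : LocalStructure (LocObj X) where
  L M := total M.base
  η M := M.toTotal
  L_L _ := rfl
  η_L _ := rfl
  mono_η M := ⟨fun g h w => hom_ext (by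
    have w := congrArg LocHom.hom w
    rwa [comp_hom, comp_hom, g.comp_idem, h.comp_idem] at w)⟩
  exists_pullback f := ⟨pullbackObj f, pullbackFst f, pullbackSnd f, rfl,
    isPullback_of_hom_eq _ rfl f rfl _ rfl _ rfl, hom_ext (by
      rw [comp_hom]
      change (pullbackSnd f).hom ≫ LocObj.idem _ = (pullbackSnd f).hom ≫ 𝟙 _
      rw [LocHom.comp_idem, Category.comp_id])⟩

theorem η_hom (M : LocObj X) : (LocalStructure.η M).hom = M.idem := rfl

theorem isInclusion_iff {A : X} {d e : A ⟶ A} {hd : rest d = d} {he : rest e = e}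
    (m : (⟨A, d, hd⟩ : LocObj X) ⟶ ⟨A, e, he⟩) : IsInclusion m ↔ m.hom = d := by
  have h : IsInclusion m ↔ m ≫ LocalStructure.η _ = LocalStructure.η _ :=
    ⟨fun ⟨_, h⟩ => h.trans (Category.comp_id _), fun h => ⟨rfl, h.trans (Category.comp_id _).symm⟩⟩
  rw [h, LocObj.hom_ext_iff, comp_hom, η_hom, η_hom, m.comp_idem]

/-- The inclusions give `d ≫ e = d` and `e ≫ d = e`, and restriction idempotents commute. -/
theorem eq_of_below_of_below {M N : LocObj X} (h : Below M N) (h' : Below N M) : M = N := by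
  obtain ⟨A, d, hd⟩ := M
  obtain ⟨B, e, he⟩ := N
  obtain ⟨m, hm⟩ := h
  obtain ⟨n, hn⟩ := h'
  obtain rfl : A = B := congrArg base hm.1
  rw [isInclusion_iff] at hm hn
  have h1 := m.comp_idem
  have h2 := n.comp_idem
  rw [hm] at h1
  rw [hn] at h2
  change d ≫ e = d at h1
  change e ≫ d = e at h2
  rw [eq_iff, ← h1, ← hd, ← he, rest_comm, hd, he, h2]

/-- The image of `f` is the idempotent `rest g` of a partial inverse `g`; onto it, `f` is invertible
with inverse `g`. -/
theorem isLocalIso_of_isRestrictionIso {M N : LocObj X} (f : M ⟶ N)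
    (hf : IsRestrictionIso f.hom) : IsLocalIso f := by
  obtain ⟨g, hfg, hgf⟩ := hf
  have hfg' : f.hom ≫ rest g = f.hom := by
    rw [← hgf, ← Category.assoc, hfg, rest_comp_self]
  have hg : rest g ≫ N.idem = rest g := by rw [← hgf, Category.assoc, f.comp_idem]
  refine ⟨⟨N.base, rest g, rest_rest g⟩,
    ⟨f.hom, f.rest_hom, hfg'⟩, ⟨rest g, rest_rest g, hg⟩, ?_, ?_, ?_⟩
  · exact (isInclusion_iff (A := N.base) _).2 rfl
  · refine ⟨⟨rest g ≫ g, ?_, ?_⟩, ?_, ?_⟩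
    · rw [rest_comp_self]
    · rw [rest_comp_self, ← f.rest_hom, ← hfg, ← Category.assoc, hgf, rest_comp_self]
    · apply LocObj.hom_ext
      change f.hom ≫ rest g ≫ g = M.idem
      rw [rest_comp_self, hfg, f.rest_hom]
    · apply LocObj.hom_ext
      change (rest g ≫ g) ≫ f.hom = rest g
      rw [rest_comp_self, hgf]
  · apply LocObj.hom_ext
    exact hfg'

end LocObj

variable {Y : Type u₂} [Category.{v₂} Y] [RestrictionStructure Y]
  {Z : Type u₃} [Category.{v₃} Z] [RestrictionStructure Z]

/-- The whiskering axioms of a strict pseudofunctor compare 2-cells along equalities of 1-cells;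
this reduces them to heterogeneous equality. -/
theorem eq_eqToHom_comp_comp_eqToHom {K : Type u₁} [Bicategory.{v₁, u₂} K]
    {X Y : K} {A A' B B' : X ⟶ Y} (p : A = A') (q : B' = B) {f : A ⟶ B} {g : A' ⟶ B'} (h : f ≍ g) :
    f = eqToHom p ≫ g ≫ eqToHom q := by
  subst p q
  rw [eqToHom_refl, eqToHom_refl, Category.id_comp, Category.comp_id, eq_of_heq h]

/-- All pullbacks of a cospan are isomorphic, so it suffices that one of them is preserved. -/
theorem map_isPullback_of_isPullback {C : Type u₁} [Category.{v₁} C] {D : Type u₂}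
    [Category.{v₂} D] (F : C ⥤ D) {P P' M N K : C} {a : M ⟶ K} {f : N ⟶ K} {p : P ⟶ M}
    {m : P ⟶ N} {p' : P' ⟶ M} {m' : P' ⟶ N} (h : IsPullback p m a f)
    (h' : IsPullback p' m' a f) (hF : IsPullback (F.map p') (F.map m') (F.map a) (F.map f)) :
    IsPullback (F.map p) (F.map m) (F.map a) (F.map f) := by
  refine hF.of_iso (F.mapIso (h'.isoIsPullback _ _ h)) (Iso.refl _) (Iso.refl _) (Iso.refl _)
    ?_ ?_ ?_ ?_ <;> simp [← Functor.map_comp]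

/-! ### Local functors and transformations from restriction ones. -/

namespace RestrictionFunctor

/-- The local functor induced by a restriction functor. -/
def toLocal (F : RestrictionFunctor X Y) : LocalFunctor (LocObj X) (LocObj Y) where
  toFunctor :=
    { obj := fun M => ⟨F.toFunctor.obj M.base, F.toFunctor.map M.idem, by
        rw [← F.map_rest, M.rest_idem]⟩
      map := fun f => ⟨F.toFunctor.map f.hom,
        (F.map_rest _).symm.trans (congrArg F.toFunctor.map f.rest_hom),
        (F.toFunctor.map_comp _ _).symm.trans (congrArg F.toFunctor.map f.comp_idem)⟩
      map_id := fun _ => rfl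
      map_comp := fun f g => LocObj.hom_ext (F.toFunctor.map_comp f.hom g.hom) }
  obj_L M := LocObj.eq_iff.2 (F.toFunctor.map_id M.base)
  map_η M := LocObj.hom_ext (by
    rw [LocObj.comp_hom, LocObj.eqToHom_hom]
    change F.toFunctor.map M.idem ≫ F.toFunctor.map (𝟙 _) ≫ 𝟙 _ = F.toFunctor.map M.idem
    rw [F.toFunctor.map_id, Category.comp_id, Category.comp_id])
  map_isPullback {M N P} f p m h := by
    refine map_isPullback_of_isPullback _ h
      (LocObj.isPullback_of_hom_eq _ rfl f rfl (LocObj.pullbackFst f) rfl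
        (LocObj.pullbackSnd f) rfl) ?_
    refine LocObj.isPullback_of_hom_eq
      (M := ⟨F.toFunctor.obj N.base, F.toFunctor.map N.idem, by rw [← F.map_rest, N.rest_idem]⟩)
      _ rfl _ ?_ _ ?_ _ rfl
    · exact (F.map_rest _).trans (congrArg rest (F.toFunctor.map_comp _ _))
    · exact F.toFunctor.map_comp _ _

end RestrictionFunctor

/-- The natural transformation induced by a restriction natural transformation. -/
def RestrictionNatTrans.toLocal {F G : RestrictionFunctor X Y} (φ : RestrictionNatTrans F G) :
    F.toLocal ⟶ G.toLocal :=
  NatTrans.mk (F := F.toLocal.toFunctor) (G := G.toLocal.toFunctor)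
    (fun M =>
      -- The component must have domain `F e`, so `φ` is restricted to it; lax naturality at `e`
      -- itself says that the result lands in `G e`.
      { hom := F.toFunctor.map M.idem ≫ φ.app M.base
        rest_hom := by
          change rest (F.toFunctor.map M.idem ≫ φ.app M.base) = F.toFunctor.map M.idem
          rw [← rest_comp_rest, φ.total, Category.comp_id, ← F.map_rest, M.rest_idem]
        comp_idem := by
          have h := φ.naturality M.idem
          rw [M.rest_idem] at h
          change (F.toFunctor.map M.idem ≫ φ.app M.base) ≫ G.toFunctor.map M.idem = _
          rw [Category.assoc, ← h]; rfl })
    (fun {M N} f => LocObj.hom_ext (by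
      have h := φ.naturality f.hom
      rw [f.rest_hom] at h
      rw [LocObj.comp_hom, LocObj.comp_hom]
      change F.toFunctor.map f.hom ≫ F.toFunctor.map N.idem ≫ φ.app N.base =
        (F.toFunctor.map M.idem ≫ φ.app M.base) ≫ G.toFunctor.map f.hom
      rw [← Category.assoc, ← F.toFunctor.map_comp, f.comp_idem, h, Category.assoc]))

theorem RestrictionNatTrans.toLocal_app_hom {F G : RestrictionFunctor X Y}
    (φ : RestrictionNatTrans F G) (M : LocObj X) :
    (NatTrans.app φ.toLocal M).hom = F.toFunctor.map M.idem ≫ φ.app M.base := rfl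

/-- Lax naturality of `φ` at the idempotent absorbs the additional factor `G e` in the middle of the
composite. -/
theorem RestrictionNatTrans.toLocal_vcomp {F G H : RestrictionFunctor X Y}
    (φ : RestrictionNatTrans F G) (ψ : RestrictionNatTrans G H) :
    (φ.vcomp ψ).toLocal = φ.toLocal ≫ ψ.toLocal :=
  NatTrans.ext (funext fun M => LocObj.hom_ext (by
    have h := φ.naturality M.idem
    rw [M.rest_idem] at h
    change F.toFunctor.map M.idem ≫ φ.app M.base ≫ ψ.app M.base =
      (F.toFunctor.map M.idem ≫ φ.app M.base) ≫ G.toFunctor.map M.idem ≫ ψ.app M.base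
    conv_lhs => rw [← Category.assoc, h]
    simp only [Category.assoc]))

theorem RestrictionNatTrans.toLocal_whiskerRight {F G : RestrictionFunctor X Y}
    (φ : RestrictionNatTrans F G) (H : RestrictionFunctor Y Z) :
    (φ.whiskerRight H).toLocal = Functor.whiskerRight φ.toLocal H.toLocal.toFunctor :=
  NatTrans.ext (funext fun _ => LocObj.hom_ext (H.toFunctor.map_comp _ _).symm)

end LocalOfRestriction

/-- The local category of a restriction category. -/
abbrev RCatLax.toLCatLax (X : RCatLax.{u}) : LCatLax.{u} := ⟨LocObj X.carrier⟩

theorem RCatLax.IsInverse.toLCatLax {X : RCatLax.{u}} (hX : X.IsInverse) :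
    X.toLCatLax.IsInverse :=
  fun f => LocObj.isLocalIso_of_isRestrictionIso f (hX f.hom)

theorem RCatLax.isAntisymm_toLCatLax (X : RCatLax.{u}) : X.toLCatLax.IsAntisymm :=
  fun _ _ h h' => LocObj.eq_of_below_of_below h h'

/-- The action of `localFunctor` on objects, 1-cells and 2-cells. -/
def localPrelaxFunctor : PrelaxFunctor InvRCatLax.{u} InvLCatLax.{u} where
  obj X := ⟨X.1.toLCatLax, RCatLax.IsInverse.toLCatLax X.2⟩
  map F := InducedBicategory.mkHom (RestrictionFunctor.toLocal F.hom)
  map₂ φ := ⟨RestrictionNatTrans.toLocal φ.hom⟩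
  map₂_id _ := InducedBicategory.Hom₂.ext (NatTrans.ext (funext fun _ =>
    LocObj.hom_ext (Category.comp_id _)))
  map₂_comp φ ψ := InducedBicategory.Hom₂.ext (RestrictionNatTrans.toLocal_vcomp φ.hom ψ.hom)

/-- The 2-functor from inverse restriction categories to inverse local categories. -/
def localFunctor : StrictPseudofunctor InvRCatLax.{u} InvLCatLax.{u} :=
  StrictPseudofunctor.mk''
    { localPrelaxFunctor with
      map_id := fun _ => rfl
      map_comp := fun _ _ => rfl
      map₂_whisker_left := fun _ _ _ _ => eq_eqToHom_comp_comp_eqToHom _ _ (heq_of_eq rfl)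
      map₂_whisker_right := fun φ H => eq_eqToHom_comp_comp_eqToHom _ _ (heq_of_eq
        (InducedBicategory.Hom₂.ext (RestrictionNatTrans.toLocal_whiskerRight φ.hom H.hom))) }

/-! ### From local categories to restriction categories. -/

section RestrictionOfLocal

universe v₁ u₁ v₂ u₂ v₃ u₃

open LocalStructure

section
variable {C : Type u₁} [Category.{v₁} C]

/-- Composing a cospan with a monomorphism does not change its cones. This reduces pullbacks of
inclusions to pullbacks of maximal inclusions. -/
theorem isPullback_comp_mono_iff {P U V B K : C} {p : P ⟶ U} {m : P ⟶ V} {n : U ⟶ B}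
    {f : V ⟶ B} (k : B ⟶ K) [Mono k] :
    IsPullback p m (n ≫ k) (f ≫ k) ↔ IsPullback p m n f := by
  have aux : ∀ {W : C} (a : W ⟶ U) (b : W ⟶ V), a ≫ n ≫ k = b ≫ f ≫ k ↔ a ≫ n = b ≫ f := by
    intro W a b
    rw [← Category.assoc, ← Category.assoc, cancel_mono]
  refine ⟨fun h => ⟨⟨(aux _ _).1 h.w⟩, ⟨Limits.PullbackCone.IsLimit.mk _
      (fun s => h.lift s.fst s.snd ((aux _ _).2 s.condition)) (fun s => h.lift_fst _ _ _)
      (fun s => h.lift_snd _ _ _) (fun s l h1 h2 => ?_)⟩⟩,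
    fun h => ⟨⟨(aux _ _).2 h.w⟩, ⟨Limits.PullbackCone.IsLimit.mk _
      (fun s => h.lift s.fst s.snd ((aux _ _).1 s.condition)) (fun s => h.lift_fst _ _ _)
      (fun s => h.lift_snd _ _ _) (fun s l h1 h2 => ?_)⟩⟩⟩
  · exact h.hom_ext (h1.trans (h.lift_fst _ _ _).symm) (h2.trans (h.lift_snd _ _ _).symm)
  · exact h.hom_ext (h1.trans (h.lift_fst _ _ _).symm) (h2.trans (h.lift_snd _ _ _).symm)

variable [LocalStructure C]

instance (M : C) : Mono (η M) := mono_η M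

namespace IsInclusion

theorem id (A : C) : IsInclusion (𝟙 A) := ⟨rfl, by simp⟩

theorem comp {U V W : C} {m : U ⟶ V} {n : V ⟶ W} (hm : IsInclusion m) (hn : IsInclusion n) :
    IsInclusion (m ≫ n) := by
  obtain ⟨h, e⟩ := hm
  obtain ⟨h', e'⟩ := hn
  refine ⟨h.trans h', ?_⟩
  rw [Category.assoc, e', ← Category.assoc, e, Category.assoc, eqToHom_trans]

theorem mono {U V : C} {m : U ⟶ V} (hm : IsInclusion m) : Mono m := by
  obtain ⟨h, e⟩ := hm
  have : Mono (m ≫ η V) := by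
    rw [e]
    infer_instance
  exact mono_of_mono m (η V)

theorem eq {U V : C} {m n : U ⟶ V} (hm : IsInclusion m) (hn : IsInclusion n) : m = n := by
  obtain ⟨_, e⟩ := hm
  obtain ⟨_, e'⟩ := hn
  rw [← cancel_mono (η V), e, e']

theorem comp_eq {U B : C} {n : U ⟶ B} (hn : IsInclusion n) :
    n ≫ η B ≫ eqToHom hn.1.symm = η U := by
  rw [← Category.assoc, hn.2, Category.assoc, eqToHom_trans, eqToHom_refl, Category.comp_id]

/-- Inclusions can be pulled back along arbitrary morphisms. -/
theorem exists_isPullback {U B V : C} {n : U ⟶ B} (hn : IsInclusion n) (f : V ⟶ B) :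
    ∃ (P : C) (p : P ⟶ U) (m : P ⟶ V), IsInclusion m ∧ IsPullback p m n f := by
  obtain ⟨P, p, m, h, hP, hm⟩ := exists_pullback (M := U) (f ≫ η B ≫ eqToHom hn.1.symm)
  refine ⟨P, p, m, ⟨h, hm⟩, ?_⟩
  rw [← hn.comp_eq] at hP
  exact (isPullback_comp_mono_iff _).1 hP

theorem η_inclusion (M : C) : IsInclusion (η M) :=
  ⟨(L_L M).symm, by rw [η_L]⟩

end IsInclusion

end

namespace LocalFunctor

variable {C : Type u₁} [Category.{v₁} C] [LocalStructure C] {D : Type u₂} [Category.{v₂} D]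
  [LocalStructure D] (F : LocalFunctor C D)

theorem isInclusion_map {U V : C} {m : U ⟶ V} (hm : IsInclusion m) :
    IsInclusion (F.toFunctor.map m) := by
  obtain ⟨h, e⟩ := hm
  refine ⟨by rw [← F.obj_L, ← F.obj_L, h], ?_⟩
  rw [← F.map_η, ← F.map_η, ← Category.assoc, ← F.toFunctor.map_comp, e, F.toFunctor.map_comp,
    eqToHom_map]
  simp

/-- Composed with `η B`, the inclusion `n` becomes `η U` up to transport, whose pullbacks `F`
preserves; `F` keeps `η B` monic because it sends it to a maximal inclusion, so the composition can
be undone. -/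
theorem map_isPullback_of_isInclusion {P U V B : C} {p : P ⟶ U} {m : P ⟶ V} {n : U ⟶ B}
    (hn : IsInclusion n) {f : V ⟶ B} (h : IsPullback p m n f) :
    IsPullback (F.toFunctor.map p) (F.toFunctor.map m) (F.toFunctor.map n)
      (F.toFunctor.map f) := by
  have h1 := (isPullback_comp_mono_iff (η B ≫ eqToHom hn.1.symm)).2 h
  rw [hn.comp_eq] at h1
  have h2 := F.map_isPullback _ _ _ h1
  rw [← hn.comp_eq, F.toFunctor.map_comp, F.toFunctor.map_comp f] at h2
  have : Mono (F.toFunctor.map (η B ≫ eqToHom hn.1.symm)) := by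
    have h3 : Mono (F.toFunctor.map (η B) ≫ eqToHom (F.obj_L B)) := by
      rw [F.map_η]
      infer_instance
    have h4 := mono_of_mono (F.toFunctor.map (η B)) (eqToHom (F.obj_L B))
    rw [F.toFunctor.map_comp, eqToHom_map]
    infer_instance
  exact (isPullback_comp_mono_iff _).1 h2

end LocalFunctor

variable (C : Type u₁) [Category.{v₁} C] [LocalStructure C]

/-- An object of the restriction category of a local category: an object that agrees with its
enlargement. -/
@[ext]
structure RelObj where
  /-- the underlying object -/
  obj : C
  L_obj : L obj = obj

variable {C}

/-- A partial morphism, encoded as the relation on generalized elements that is represented by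
a morphism defined on some `V ≤ A`. -/
@[ext]
structure PartialHom (A B : RelObj C) where
  /-- the relation on generalized elements -/
  rel : ∀ W : C, (W ⟶ A.obj) → (W ⟶ B.obj) → Prop
  exists_span : ∃ (V : C) (m : V ⟶ A.obj) (f : V ⟶ B.obj), IsInclusion m ∧
    ∀ (W : C) (a : W ⟶ A.obj) (b : W ⟶ B.obj), rel W a b ↔ ∃ h : W ⟶ V, h ≫ m = a ∧ h ≫ f = b

namespace PartialHom

theorem ext_rel {A B : RelObj C} {R S : PartialHom A B}
    (h : ∀ (W : C) (a : W ⟶ A.obj) (b : W ⟶ B.obj), R.rel W a b ↔ S.rel W a b) : R = S :=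
  PartialHom.ext (funext fun W => funext fun a => funext fun b => propext (h W a b))

/-- The left leg of the span is monic, so the relation is a partial function. -/
theorem rel_unique {A B : RelObj C} (R : PartialHom A B) {W : C} {a : W ⟶ A.obj}
    {b b' : W ⟶ B.obj} (h : R.rel W a b) (h' : R.rel W a b') : b = b' := by
  obtain ⟨V, m, f, hm, hR⟩ := R.exists_span
  obtain ⟨k, rfl, rfl⟩ := (hR _ _ _).1 h
  obtain ⟨l, hl, rfl⟩ := (hR _ _ _).1 h'
  have := hm.mono
  rw [(cancel_mono m).1 hl]

theorem rel_comp {A B : RelObj C} (R : PartialHom A B) {W W' : C} {a : W ⟶ A.obj}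
    {b : W ⟶ B.obj} (h : R.rel W a b) (k : W' ⟶ W) : R.rel W' (k ≫ a) (k ≫ b) := by
  obtain ⟨V, m, f, hm, hR⟩ := R.exists_span
  obtain ⟨l, rfl, rfl⟩ := (hR _ _ _).1 h
  exact (hR _ _ _).2 ⟨k ≫ l, by simp⟩

/-- The identity relation. -/
def id (A : RelObj C) : PartialHom A A where
  rel _ a b := a = b
  exists_span := ⟨A.obj, 𝟙 _, 𝟙 _, IsInclusion.id _, by simp⟩

/-- The composite of two relations. -/
def comp {A B D : RelObj C} (R : PartialHom A B) (S : PartialHom B D) : PartialHom A D where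
  rel W a c := ∃ b, R.rel W a b ∧ S.rel W b c
  exists_span := by
    obtain ⟨V, m, f, hm, hR⟩ := R.exists_span
    obtain ⟨U, n, g, hn, hS⟩ := S.exists_span
    -- The composite is defined on the part of `V` that `f` sends into `U`.
    obtain ⟨P, p, m', hm', hP⟩ := hn.exists_isPullback f
    refine ⟨P, m' ≫ m, p ≫ g, hm'.comp hm, fun W a c => ⟨?_, ?_⟩⟩
    · rintro ⟨b, hab, hbc⟩
      obtain ⟨h, rfl, rfl⟩ := (hR _ _ _).1 hab
      obtain ⟨k, hk, rfl⟩ := (hS _ _ _).1 hbc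
      refine ⟨hP.lift k h hk, ?_, ?_⟩
      · rw [← Category.assoc, hP.lift_snd]
      · rw [← Category.assoc, hP.lift_fst]
    · rintro ⟨h, rfl, rfl⟩
      refine ⟨h ≫ m' ≫ f, (hR _ _ _).2 ⟨h ≫ m', by simp, by simp⟩,
        (hS _ _ _).2 ⟨h ≫ p, ?_, by simp⟩⟩
      rw [Category.assoc, hP.w]

end PartialHom

instance : Category (RelObj C) where
  Hom A B := PartialHom A B
  id A := PartialHom.id A
  comp R S := PartialHom.comp R S
  id_comp _ := PartialHom.ext_rel fun _ a _ =>
    ⟨fun ⟨_, h, h'⟩ => h.symm ▸ h', fun h => ⟨a, rfl, h⟩⟩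
  comp_id _ := PartialHom.ext_rel fun _ _ b =>
    ⟨fun ⟨_, h, h'⟩ => h' ▸ h, fun h => ⟨b, h, rfl⟩⟩
  assoc _ _ _ := PartialHom.ext_rel fun _ _ _ =>
    ⟨fun ⟨x, ⟨y, h, h'⟩, h''⟩ => ⟨y, h, x, h', h''⟩, fun ⟨y, h, x, h', h''⟩ => ⟨x, ⟨y, h, h'⟩, h''⟩⟩

namespace RelObj

theorem hom_ext {A B : RelObj C} {R S : A ⟶ B}
    (h : ∀ (W : C) (a : W ⟶ A.obj) (b : W ⟶ B.obj), R.rel W a b ↔ S.rel W a b) : R = S :=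
  PartialHom.ext_rel h

theorem comp_rel {A B D : RelObj C} (R : A ⟶ B) (S : B ⟶ D) {W : C} {a : W ⟶ A.obj}
    {c : W ⟶ D.obj} : (R ≫ S).rel W a c ↔ ∃ b, R.rel W a b ∧ S.rel W b c := Iff.rfl

theorem id_rel (A : RelObj C) {W : C} {a b : W ⟶ A.obj} :
    PartialHom.rel (𝟙 A) W a b ↔ a = b := Iff.rfl

theorem eqToHom_rel {A B : RelObj C} (h : A = B) {W : C} {a : W ⟶ A.obj} {b : W ⟶ B.obj} :
    (eqToHom h).rel W a b ↔ a ≫ eqToHom (congrArg RelObj.obj h) = b := by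
  subst h
  rw [eqToHom_refl, eqToHom_refl, Category.comp_id, id_rel]

/-- The restriction of a relation is the diagonal on the elements where it is defined. Among the
axioms only `comp_rest` needs single-valuedness. -/
instance : RestrictionStructure (RelObj C) where
  rest {A B} R :=
    { rel := fun W a a' => a = a' ∧ ∃ b, R.rel W a b
      exists_span := by
        obtain ⟨V, m, f, hm, hR⟩ := R.exists_span
        refine ⟨V, m, m, hm, fun W a a' => ⟨?_, ?_⟩⟩
        · rintro ⟨rfl, b, h⟩
          obtain ⟨k, rfl, -⟩ := (hR _ _ _).1 h
          exact ⟨k, rfl, rfl⟩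
        · rintro ⟨k, rfl, rfl⟩
          exact ⟨rfl, k ≫ f, (hR _ _ _).2 ⟨k, rfl, rfl⟩⟩ }
  rest_comp_self R := hom_ext fun W a b =>
    ⟨by
      rintro ⟨_, ⟨rfl, _⟩, h⟩
      exact h, fun h => ⟨a, ⟨rfl, b, h⟩, h⟩⟩
  rest_comm R S := hom_ext fun W a b => ⟨by
      rintro ⟨_, ⟨rfl, x⟩, rfl, y⟩
      exact ⟨a, ⟨rfl, y⟩, rfl, x⟩, by
      rintro ⟨_, ⟨rfl, x⟩, rfl, y⟩
      exact ⟨a, ⟨rfl, y⟩, rfl, x⟩⟩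
  rest_rest_comp R S := hom_ext fun W a b => ⟨by
      rintro ⟨_, ⟨rfl, x⟩, rfl, c, y⟩
      exact ⟨rfl, c, a, ⟨rfl, x⟩, y⟩, by
      rintro ⟨rfl, c, _, ⟨rfl, x⟩, y⟩
      exact ⟨a, ⟨rfl, x⟩, rfl, c, y⟩⟩
  comp_rest R S := hom_ext fun W a b =>
    ⟨by
      rintro ⟨b', x, rfl, c, y⟩
      exact ⟨a, ⟨rfl, c, b', x, y⟩, x⟩, by
      rintro ⟨_, ⟨rfl, c, b', x, y⟩, z⟩
      obtain rfl := R.rel_unique x z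
      exact ⟨b', z, rfl, c, y⟩⟩

theorem rest_rel {A B : RelObj C} (R : A ⟶ B) {W : C} {a a' : W ⟶ A.obj} :
    (RestrictionStructure.rest R).rel W a a' ↔ a = a' ∧ ∃ b, R.rel W a b := Iff.rfl

/-- Writing the right leg as an isomorphism `g` followed by an inclusion `n`, the converse relation
is represented by the span with legs `n` and `inv g ≫ m`. A relation and converse that are both
single-valued are partial inverses. -/
theorem isRestrictionIso_of_isLocalIso {A B : RelObj C} (R : A ⟶ B)
    (hC : ∀ {V : C} (f : V ⟶ B.obj), IsLocalIso f) : IsRestrictionIso R := by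
  obtain ⟨V, m, f, hm, hR⟩ := R.exists_span
  obtain ⟨U, g, n, hn, hg, rfl⟩ := hC f
  have hS : ∀ (W : C) (b : W ⟶ B.obj) (a : W ⟶ A.obj), R.rel W a b ↔
      ∃ h : W ⟶ U, h ≫ n = b ∧ h ≫ inv g ≫ m = a := fun W b a => by
    rw [hR]
    constructor
    · rintro ⟨h, rfl, rfl⟩
      exact ⟨h ≫ g, by simp, by simp⟩
    · rintro ⟨h, rfl, rfl⟩
      exact ⟨h ≫ inv g, by simp, by simp⟩
  let S : B ⟶ A := ⟨fun W b a => R.rel W a b, U, n, inv g ≫ m, hn, hS⟩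
  refine ⟨S, hom_ext fun W a a' => ?_, hom_ext fun W b b' => ?_⟩
  · refine ⟨fun ⟨b, h, h'⟩ => ⟨S.rel_unique h h', b, h⟩, fun ⟨h, b, h'⟩ => ⟨b, h', h ▸ h'⟩⟩
  · refine ⟨fun ⟨a, h, h'⟩ => ⟨R.rel_unique h h', a, h⟩, fun ⟨h, a, h'⟩ => ⟨a, h', h ▸ h'⟩⟩

/-- A morphism regarded as a total partial morphism. -/
def graph {A B : RelObj C} (f : A.obj ⟶ B.obj) : A ⟶ B where
  rel _ a b := a ≫ f = b
  exists_span := ⟨A.obj, 𝟙 _, f, IsInclusion.id _, by simp⟩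

theorem isTotal_graph {A B : RelObj C} (f : A.obj ⟶ B.obj) : IsTotal (graph f) :=
  hom_ext fun _ a _ => ⟨fun h => h.1, fun h => ⟨h, a ≫ f, rfl⟩⟩

end RelObj

variable {D : Type u₂} [Category.{v₂} D] [LocalStructure D]
  {E : Type u₃} [Category.{v₃} E] [LocalStructure E]

/-! ### Restriction functors and transformations from local ones. -/

namespace LocalFunctor

/-- The action of a local functor on the objects that agree with their enlargement. -/
abbrev mapObj (F : LocalFunctor C D) (A : RelObj C) : RelObj D :=
  ⟨F.toFunctor.obj A.obj, by rw [← F.obj_L, A.L_obj]⟩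

/-- Every related pair factors through the generic pair `(m, f)`, so the image relation, defined
without choosing a span, is represented by the image of any span. -/
theorem exists_iff_of_span (F : LocalFunctor C D) {A B : RelObj C} (R : A ⟶ B)
    {V : C} {m : V ⟶ A.obj} {f : V ⟶ B.obj}
    (hR : ∀ (W : C) (a : W ⟶ A.obj) (b : W ⟶ B.obj),
      R.rel W a b ↔ ∃ h : W ⟶ V, h ≫ m = a ∧ h ≫ f = b)
    (W : D) (x : W ⟶ F.toFunctor.obj A.obj) (y : W ⟶ F.toFunctor.obj B.obj) :
    (∃ (W' : C) (a : W' ⟶ A.obj) (b : W' ⟶ B.obj) (h : W ⟶ F.toFunctor.obj W'), R.rel W' a b ∧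
      h ≫ F.toFunctor.map a = x ∧ h ≫ F.toFunctor.map b = y) ↔
    ∃ h : W ⟶ F.toFunctor.obj V, h ≫ F.toFunctor.map m = x ∧ h ≫ F.toFunctor.map f = y := by
  constructor
  · rintro ⟨W', a, b, h, hab, rfl, rfl⟩
    obtain ⟨k, rfl, rfl⟩ := (hR _ _ _).1 hab
    exact ⟨h ≫ F.toFunctor.map k, by simp, by simp⟩
  · rintro ⟨h, rfl, rfl⟩
    exact ⟨V, m, f, h, (hR _ _ _).2 ⟨𝟙 _, by simp⟩, rfl, rfl⟩

/-- The action of a local functor on partial morphisms. -/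
def mapHom (F : LocalFunctor C D) {A B : RelObj C} (R : A ⟶ B) : F.mapObj A ⟶ F.mapObj B where
  rel W x y := ∃ (W' : C) (a : W' ⟶ A.obj) (b : W' ⟶ B.obj) (h : W ⟶ F.toFunctor.obj W'),
    R.rel W' a b ∧ h ≫ F.toFunctor.map a = x ∧ h ≫ F.toFunctor.map b = y
  exists_span := by
    obtain ⟨V, m, f, hm, hR⟩ := R.exists_span
    exact ⟨F.toFunctor.obj V, F.toFunctor.map m, F.toFunctor.map f, F.isInclusion_map hm,
      F.exists_iff_of_span R hR⟩

/-- Images of composable pairs compose formally. Conversely, elements that match only after applying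
`F` must factor through the image of the pullback, and this is where its preservation is needed. -/
theorem mapHom_comp (F : LocalFunctor C D) {A B K : RelObj C} (R : A ⟶ B) (S : B ⟶ K) :
    F.mapHom (R ≫ S) = F.mapHom R ≫ F.mapHom S := by
  refine RelObj.hom_ext fun W x z => ⟨?_, ?_⟩
  · rintro ⟨W', a, c, h, ⟨b, hab, hbc⟩, rfl, rfl⟩
    exact ⟨h ≫ F.toFunctor.map b, ⟨W', a, b, h, hab, rfl, rfl⟩, ⟨W', b, c, h, hbc, rfl, rfl⟩⟩
  · rintro ⟨y, hxy, hyz⟩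
    obtain ⟨V, m, f, hm, hR⟩ := R.exists_span
    obtain ⟨U, n, g, hn, hS⟩ := S.exists_span
    obtain ⟨P, p, m', hm', hP⟩ := hn.exists_isPullback f
    have hFP := F.map_isPullback_of_isInclusion hn hP
    obtain ⟨h, rfl, rfl⟩ := (F.exists_iff_of_span R hR _ _ _).1 hxy
    obtain ⟨k, hk, rfl⟩ := (F.exists_iff_of_span S hS _ _ _).1 hyz
    refine ⟨P, m' ≫ m, p ≫ g, hFP.lift k h hk, ⟨m' ≫ f, (hR _ _ _).2 ⟨m', rfl, rfl⟩,
      (hS _ _ _).2 ⟨p, hP.w, rfl⟩⟩, ?_, ?_⟩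
    · rw [F.toFunctor.map_comp, ← Category.assoc, hFP.lift_snd]
    · rw [F.toFunctor.map_comp, ← Category.assoc, hFP.lift_fst]

/-- The restriction functor induced by a local functor. -/
def toRestriction (F : LocalFunctor C D) : RestrictionFunctor (RelObj C) (RelObj D) where
  toFunctor :=
    { obj := F.mapObj
      map := F.mapHom
      map_id := fun A => RelObj.hom_ext fun W x y => ⟨by
        rintro ⟨W', a, b, h, rfl, rfl, rfl⟩
        rfl, by
        rintro rfl
        exact ⟨A.obj, 𝟙 _, 𝟙 _, x, rfl, by simp⟩⟩
      map_comp := F.mapHom_comp }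
  map_rest R := RelObj.hom_ext fun W x y => ⟨by
    rintro ⟨W', a, _, h, ⟨rfl, b, hab⟩, rfl, rfl⟩
    exact ⟨rfl, _, W', a, b, h, hab, rfl, rfl⟩, by
    rintro ⟨rfl, _, W', a, b, h, hab, rfl, rfl⟩
    exact ⟨W', a, a, h, ⟨rfl, b, hab⟩, rfl, rfl⟩⟩

/-- The restriction natural transformation induced by a natural transformation. -/
def natTransToRestriction {F G : LocalFunctor C D} (φ : F.toFunctor ⟶ G.toFunctor) :
    RestrictionNatTrans F.toRestriction G.toRestriction where
  app A := RelObj.graph (A := F.mapObj A) (B := G.mapObj A) (φ.app A.obj)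
  total A := RelObj.isTotal_graph _
  naturality R := RelObj.hom_ext fun W x z => ⟨by
    rintro ⟨y, ⟨W', a, b, h, hab, rfl, rfl⟩, rfl⟩
    refine ⟨_, ⟨W', a, a, h, ⟨rfl, b, hab⟩, rfl, rfl⟩, _, rfl, W', a, b, h ≫ φ.app W', hab,
      ?_, ?_⟩ <;> simp, by
    rintro ⟨_, ⟨W', a, _, h, ⟨rfl, b, hab⟩, rfl, rfl⟩, _, rfl, hz⟩
    refine ⟨_, ⟨W', a, b, h, hab, rfl, rfl⟩, ?_⟩
    -- Single-valuedness identifies the given value `z` with the one obtained from naturality of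
    -- `φ`.
    refine (G.mapHom R).rel_unique ⟨W', a, b, h ≫ φ.app W', hab, ?_, ?_⟩ hz <;> simp⟩

end LocalFunctor

end RestrictionOfLocal

/-- The restriction category of a local category. -/
abbrev LCatLax.toRCatLax (C : LCatLax.{u}) : RCatLax.{u} := ⟨RelObj C.carrier⟩

theorem LCatLax.IsInverse.toRCatLax {C : LCatLax.{u}} (hC : C.IsInverse) :
    C.toRCatLax.IsInverse :=
  fun R => RelObj.isRestrictionIso_of_isLocalIso R fun f => hC f

/-! ### Heterogeneous equality of 1-cells and 2-cells. -/

section HEq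

universe v₁ u₁ v₂ u₂ w

theorem RestrictionFunctor.ext_functor {X : Type u₁} [Category.{v₁} X] [RestrictionStructure X]
    {Y : Type u₂} [Category.{v₂} Y] [RestrictionStructure Y] {F G : RestrictionFunctor X Y}
    (h : F.toFunctor = G.toFunctor) : F = G := by
  obtain ⟨F, _⟩ := F
  obtain ⟨G, _⟩ := G
  congr

theorem RestrictionNatTrans.hext {X : Type u₁} [Category.{v₁} X] [RestrictionStructure X]
    {Y : Type u₂} [Category.{v₂} Y] [RestrictionStructure Y] {F F' G G' : RestrictionFunctor X Y}
    (hF : F = F') (hG : G = G') {φ : RestrictionNatTrans F G} {ψ : RestrictionNatTrans F' G'}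
    (h : ∀ A, φ.app A ≍ ψ.app A) : φ ≍ ψ := by
  subst hF hG
  exact heq_of_eq (RestrictionNatTrans.ext (funext fun A => eq_of_heq (h A)))

theorem LocalFunctor.ext_functor {C : Type u₁} [Category.{v₁} C] [LocalStructure C]
    {D : Type u₂} [Category.{v₂} D] [LocalStructure D] {F G : LocalFunctor C D}
    (h : F.toFunctor = G.toFunctor) : F = G := by
  obtain ⟨F, _⟩ := F
  obtain ⟨G, _⟩ := G
  congr

theorem LocalFunctor.natTrans_hext {C : Type u₁} [Category.{v₁} C] [LocalStructure C]
    {D : Type u₂} [Category.{v₂} D] [LocalStructure D] {F F' G G' : LocalFunctor C D}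
    (hF : F = F') (hG : G = G') {φ : F.toFunctor ⟶ G.toFunctor}
    {ψ : F'.toFunctor ⟶ G'.toFunctor} (h : ∀ A, φ.app A ≍ ψ.app A) : φ ≍ ψ := by
  subst hF hG
  exact heq_of_eq (NatTrans.ext (funext fun A => eq_of_heq (h A)))

theorem hom₂_hext {B : Type w} {K : Type u₁} [Bicategory.{v₁, u₂} K] {F : B → K}
    {X Y : InducedBicategory K F} {f f' g g' : X ⟶ Y} (hf : f = f') (hg : g = g') {φ : f ⟶ g}
    {ψ : f' ⟶ g'} (h : φ.hom ≍ ψ.hom) : φ ≍ ψ := by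
  subst hf hg
  exact heq_of_eq (InducedBicategory.Hom₂.ext (eq_of_heq h))

/-- This has the shape of the 2-cell condition in `TwoNatTrans`, which then reduces to comparing
components. -/
theorem comp_eqToHom_eq_eqToHom_comp {K : Type u₁} [Bicategory.{v₁, u₂} K] {X Y : K}
    {A A' B B' : X ⟶ Y} (p : B = B') (q : A = A') {f : A ⟶ B} {g : A' ⟶ B'} (h : f ≍ g) :
    f ≫ eqToHom p = eqToHom q ≫ g := by
  subst p q
  rw [eqToHom_refl, eqToHom_refl, Category.id_comp, Category.comp_id, eq_of_heq h]

end HEq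

/-! ### Strict 2-functoriality of partial morphisms. -/

namespace LocalFunctor

universe v₁ u₁ v₂ u₂ v₃ u₃

variable {C : Type u₁} [Category.{v₁} C] [LocalStructure C] {D : Type u₂} [Category.{v₂} D]
  [LocalStructure D] {E : Type u₃} [Category.{v₃} E] [LocalStructure E]

theorem toRestriction_id : (LocalFunctor.id C).toRestriction = RestrictionFunctor.id _ :=
  RestrictionFunctor.ext_functor (Functor.hext (fun _ => rfl) fun _ _ R =>
    heq_of_eq (RelObj.hom_ext fun W a b => ⟨by
      rintro ⟨W', a, b, h, hab, rfl, rfl⟩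
      exact R.rel_comp hab h, fun h => ⟨W, a, b, 𝟙 W, h, Category.id_comp _, Category.id_comp _⟩⟩))

theorem comp_map_comp (G : LocalFunctor D E) {W : E} {A B K : D} (h : W ⟶ G.toFunctor.obj A)
    (k : A ⟶ B) (a : B ⟶ K) :
    (h ≫ G.toFunctor.map k) ≫ G.toFunctor.map a = h ≫ G.toFunctor.map (k ≫ a) := by
  simp

theorem mapHom_graph (F : LocalFunctor C D) {A B : RelObj C} (f : A.obj ⟶ B.obj) :
    F.mapHom (RelObj.graph f) =
      RelObj.graph (A := F.mapObj A) (B := F.mapObj B) (F.toFunctor.map f) :=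
  RelObj.hom_ext fun W x y => ⟨by
    rintro ⟨W', a, _, h, rfl, rfl, rfl⟩
    exact F.comp_map_comp _ _ _, by
    rintro rfl
    exact ⟨A.obj, 𝟙 _, f, x, Category.id_comp _, by simp, rfl⟩⟩

theorem toRestriction_comp (F : LocalFunctor C D) (G : LocalFunctor D E) :
    (F.comp G).toRestriction = F.toRestriction.comp G.toRestriction :=
  RestrictionFunctor.ext_functor (Functor.hext (fun _ => rfl) fun _ _ R =>
    heq_of_eq (RelObj.hom_ext fun W x y => ⟨by
      rintro ⟨W', a, b, h, hab, rfl, rfl⟩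
      exact ⟨_, _, _, h, ⟨W', a, b, 𝟙 _, hab, Category.id_comp _, Category.id_comp _⟩, rfl, rfl⟩, by
      rintro ⟨_, _, _, h, ⟨W', a, b, k, hab, rfl, rfl⟩, rfl, rfl⟩
      exact ⟨W', a, b, h ≫ G.toFunctor.map k, hab, G.comp_map_comp _ _ _, G.comp_map_comp _ _ _⟩⟩))

theorem natTransToRestriction_id (F : LocalFunctor C D) :
    natTransToRestriction (𝟙 F.toFunctor) = RestrictionNatTrans.id F.toRestriction :=
  RestrictionNatTrans.ext (funext fun _ => RelObj.hom_ext fun _ a _ => by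
    change a ≫ 𝟙 _ = _ ↔ a = _
    rw [Category.comp_id])

theorem natTransToRestriction_vcomp {F G H : LocalFunctor C D} (φ : F.toFunctor ⟶ G.toFunctor)
    (ψ : G.toFunctor ⟶ H.toFunctor) : natTransToRestriction (F := F) (G := H) (φ ≫ ψ) =
      (natTransToRestriction φ).vcomp (natTransToRestriction ψ) :=
  RestrictionNatTrans.ext (funext fun A => RelObj.hom_ext fun W a c =>
    ⟨fun h => ⟨_, rfl, (Category.assoc _ _ _).trans h⟩, by
      rintro ⟨_, rfl, rfl⟩
      exact (Category.assoc _ _ _).symm⟩)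

theorem natTransToRestriction_whiskerRight_app {F G : LocalFunctor C D}
    (φ : F.toFunctor ⟶ G.toFunctor) (H : LocalFunctor D E) (A : RelObj C) :
    (natTransToRestriction (F := F.comp H) (G := G.comp H)
      (Functor.whiskerRight φ H.toFunctor)).app A =
      ((natTransToRestriction φ).whiskerRight H.toRestriction).app A :=
  (H.mapHom_graph (A := F.mapObj A) (B := G.mapObj A) (φ.app A.obj)).symm

end LocalFunctor

/-- The action of `restrictionFunctor` on objects, 1-cells and 2-cells. -/
def restrictionPrelaxFunctor : PrelaxFunctor InvLCatLax.{u} InvRCatLax.{u} where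
  obj C := ⟨C.1.toRCatLax, LCatLax.IsInverse.toRCatLax C.2⟩
  map F := InducedBicategory.mkHom (LocalFunctor.toRestriction F.hom)
  map₂ φ := ⟨LocalFunctor.natTransToRestriction φ.hom⟩
  map₂_id F := InducedBicategory.Hom₂.ext (LocalFunctor.natTransToRestriction_id F.hom)
  map₂_comp φ ψ := InducedBicategory.Hom₂.ext
    (LocalFunctor.natTransToRestriction_vcomp φ.hom ψ.hom)

theorem restrictionPrelaxFunctor_map_comp {C D E : InvLCatLax.{u}} (F : C ⟶ D) (G : D ⟶ E) :
    restrictionPrelaxFunctor.map (F ≫ G) =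
      restrictionPrelaxFunctor.map F ≫ restrictionPrelaxFunctor.map G :=
  InducedBicategory.Hom.ext (LocalFunctor.toRestriction_comp F.hom G.hom)

/-- The 2-functor from inverse local categories to inverse restriction categories. -/
def restrictionFunctor : StrictPseudofunctor InvLCatLax.{u} InvRCatLax.{u} :=
  StrictPseudofunctor.mk''
    { restrictionPrelaxFunctor with
      map_id := fun _ => InducedBicategory.Hom.ext LocalFunctor.toRestriction_id
      map_comp := restrictionPrelaxFunctor_map_comp
      map₂_whisker_left := fun F G H _ => eq_eqToHom_comp_comp_eqToHom _ _ (hom₂_hext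
        (restrictionPrelaxFunctor_map_comp F G) (restrictionPrelaxFunctor_map_comp F H)
        (RestrictionNatTrans.hext (LocalFunctor.toRestriction_comp F.hom G.hom)
          (LocalFunctor.toRestriction_comp F.hom H.hom) fun _ => heq_of_eq rfl))
      map₂_whisker_right := fun {_ _ _ F G} _ H => eq_eqToHom_comp_comp_eqToHom _ _ (hom₂_hext
        (restrictionPrelaxFunctor_map_comp F H) (restrictionPrelaxFunctor_map_comp G H)
        (RestrictionNatTrans.hext (LocalFunctor.toRestriction_comp F.hom H.hom)
          (LocalFunctor.toRestriction_comp G.hom H.hom) fun _ => heq_of_eq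
            (LocalFunctor.natTransToRestriction_whiskerRight_app _ H.hom _))) }

open RestrictionStructure LocalStructure

/-! ### Strict sections of fully faithful functors. -/

section SectionFunctor

universe v₁ u₁ v₂ u₂

variable {C : Type u₁} [Category.{v₁} C] {D : Type u₂} [Category.{v₂} D] (F : C ⥤ D) [F.Full]
  [F.Faithful] (g : D → C) (hg : ∀ Y, F.obj (g Y) = Y)

/-- A section on objects of a fully faithful functor extends to a functor. -/
noncomputable def sectionFunctor : D ⥤ C where
  obj := g
  map {Y Z} f := F.preimage (eqToHom (hg Y) ≫ f ≫ eqToHom (hg Z).symm)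
  map_id Y := F.map_injective (by simp)
  map_comp f g := F.map_injective (by simp)

theorem obj_sectionFunctor_obj (Y : D) : F.obj ((sectionFunctor F g hg).obj Y) = Y := hg Y

theorem map_sectionFunctor_map {Y Z : D} (f : Y ⟶ Z) :
    F.map ((sectionFunctor F g hg).map f) =
      eqToHom (obj_sectionFunctor_obj F g hg Y) ≫ f ≫
        eqToHom (obj_sectionFunctor_obj F g hg Z).symm :=
  F.map_preimage _

theorem sectionFunctor_comp : sectionFunctor F g hg ⋙ F = 𝟭 D :=
  CategoryTheory.Functor.ext hg (fun _ _ f => map_sectionFunctor_map F g hg f)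

/-- When `g` also inverts `F` on objects, faithfulness makes the extension a strict two-sided
inverse. -/
theorem comp_sectionFunctor (h : ∀ X, g (F.obj X) = X) : F ⋙ sectionFunctor F g hg = 𝟭 C := by
  have h' : ∀ X, (sectionFunctor F g hg).obj (F.obj X) = X := h
  have hmap : ∀ {X Y : C} (f : X ⟶ Y), (sectionFunctor F g hg).map (F.map f) =
      eqToHom (h' X) ≫ f ≫ eqToHom (h' Y).symm := fun f => F.map_injective (by
    rw [map_sectionFunctor_map, F.map_comp, F.map_comp, eqToHom_map, eqToHom_map])
  exact CategoryTheory.Functor.ext h' (fun _ _ f => hmap f)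

/-- A section on objects of a fully faithful functor extends to an inverse up to isomorphism. -/
noncomputable def compSectionFunctorIso : F ⋙ sectionFunctor F g hg ≅ 𝟭 C :=
  NatIso.ofComponents
    (fun X => F.preimageIso (eqToIso (obj_sectionFunctor_obj F g hg (F.obj X))))
    (fun {X Y} f => F.map_injective (by
      have h : F.map ((sectionFunctor F g hg).map (F.map f)) ≫
          eqToHom (obj_sectionFunctor_obj F g hg (F.obj Y)) =
          eqToHom (obj_sectionFunctor_obj F g hg (F.obj X)) ≫ F.map f := by
        rw [map_sectionFunctor_map, Category.assoc, Category.assoc, eqToHom_trans, eqToHom_refl,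
          Category.comp_id]
      rw [F.map_comp, F.map_comp]
      simpa using h))

theorem isEquivalence_of_section {g : D → C} (hg : ∀ Y, F.obj (g Y) = Y) : F.IsEquivalence where
  essSurj := ⟨fun Y => ⟨g Y, ⟨eqToIso (hg Y)⟩⟩⟩

theorem isEquivalence_sectionFunctor : (sectionFunctor F g hg).IsEquivalence := by
  have := isEquivalence_of_section F hg
  have : (sectionFunctor F g hg ⋙ F).IsEquivalence := by
    rw [sectionFunctor_comp]
    infer_instance
  exact Functor.isEquivalence_of_comp_right _ F

end SectionFunctor

section HEq

universe v₁ u₁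

/-- Endpoints that agree only propositionally are handled by transporting generalized elements, so
that no casts of relations appear. -/
theorem RelObj.hom_hext {C : Type u₁} [Category.{v₁} C] [LocalStructure C] {A A' B B' : RelObj C}
    (hA : A.obj = A'.obj) (hB : B.obj = B'.obj) {R : A ⟶ B} {S : A' ⟶ B'}
    (h : ∀ (W : C) (a : W ⟶ A.obj) (b : W ⟶ B.obj),
      R.rel W a b ↔ S.rel W (a ≫ eqToHom hA) (b ≫ eqToHom hB)) : R ≍ S := by
  obtain rfl := RelObj.ext hA
  obtain rfl := RelObj.ext hB
  refine heq_of_eq (RelObj.hom_ext fun W a b => ?_)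
  have := h W a b
  rwa [eqToHom_refl, eqToHom_refl, Category.comp_id, Category.comp_id] at this

theorem LocObj.hom_hext {X : Type u₁} [Category.{v₁} X] [RestrictionStructure X]
    {M M' N N' : LocObj X} (hM : M = M') (hN : N = N') {f : M ⟶ N} {g : M' ⟶ N'}
    (h : f.hom ≍ g.hom) : f ≍ g := by
  subst hM hN
  exact heq_of_eq (LocObj.hom_ext (eq_of_heq h))

end HEq

/-! ### The unit: a restriction category and its double transform. -/

section Unit

universe v₁ u₁ v₂ u₂

variable {X : Type u₁} [Category.{v₁} X] [RestrictionStructure X]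
  {Y : Type u₂} [Category.{v₂} Y] [RestrictionStructure Y]

theorem rest_comp_rest_self {A B D : X} (f : A ⟶ B) (g : B ⟶ D) :
    rest (f ≫ g) ≫ rest f = rest (f ≫ g) := by
  rw [rest_comm, rest_rest_comp, ← Category.assoc, rest_comp_self]

theorem rest_eqToHom_comp_comp_eqToHom {A A' B B' : X} (p : A = A') (q : B' = B) (f : A' ⟶ B') :
    rest (eqToHom p ≫ f ≫ eqToHom q) = eqToHom p ≫ rest f ≫ eqToHom p.symm := by
  subst p q
  simp

/-- The comparison on objects. -/
abbrev unitObj (A : X) : RelObj (LocObj X) := ⟨LocObj.total A, rfl⟩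

/-- If `a ≫ f = b`, then `rest (a ≫ f)` is the domain idempotent of `W`, so `a ≫ rest f = a` and `a`
factors through the domain of `f`. -/
theorem comp_eq_iff_exists {A B : X} (f : A ⟶ B) (W : LocObj X) (a : W ⟶ LocObj.total A)
    (b : W ⟶ LocObj.total B) : a.hom ≫ f = b.hom ↔
      ∃ h : W ⟶ ⟨A, rest f, rest_rest f⟩,
        h ≫ (⟨rest f, rest_rest f, Category.comp_id _⟩ :
          LocHom ⟨A, rest f, rest_rest f⟩ (LocObj.total A)) = a ∧
        h ≫ (⟨f, rfl, Category.comp_id _⟩ :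
          LocHom ⟨A, rest f, rest_rest f⟩ (LocObj.total B)) = b := by
  constructor
  · intro h
    have ha : a.hom ≫ rest f = a.hom := by
      rw [comp_rest, h, b.rest_hom, a.idem_comp]
    exact ⟨⟨a.hom, a.rest_hom, ha⟩, LocObj.hom_ext ha, LocObj.hom_ext h⟩
  · rintro ⟨h, rfl, rfl⟩
    change (h.hom ≫ rest f) ≫ f = h.hom ≫ f
    rw [Category.assoc, rest_comp_self]

/-- The comparison on morphisms. -/
def unitHom {A B : X} (f : A ⟶ B) : unitObj A ⟶ unitObj B where
  rel _ a b := a.hom ≫ f = b.hom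
  exists_span := ⟨⟨A, rest f, rest_rest f⟩, ⟨rest f, rest_rest f, Category.comp_id _⟩,
    ⟨f, rfl, Category.comp_id _⟩, (LocObj.isInclusion_iff (A := A) _).2 rfl, comp_eq_iff_exists f⟩

theorem unitHom_rel {A B : X} (f : A ⟶ B) {W : LocObj X} {a : W ⟶ LocObj.total A}
    {b : W ⟶ LocObj.total B} : (unitHom f).rel W a b ↔ a.hom ≫ f = b.hom := Iff.rfl

/-- Having enlargement `(A, 1)` forces the apex of the span to be `(A, e)` with inclusion `e`; its
right leg is then a map `A ⟶ B` of `X` with domain `e`. -/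
theorem exists_unitHom_eq {A B : X} (R : unitObj A ⟶ unitObj B) : ∃ f : A ⟶ B, unitHom f = R := by
  obtain ⟨⟨A', e, he⟩, m, f, hm, hR⟩ := R.exists_span
  obtain rfl : A' = A := congrArg LocObj.base hm.1
  have hme : m.hom = e := (LocObj.isInclusion_iff (A := A') m).1 hm
  refine ⟨f.hom, RelObj.hom_ext fun W a b => ?_⟩
  rw [hR, unitHom_rel]
  have hf : rest f.hom = e := f.rest_hom
  constructor
  · intro h
    have ha : a.hom ≫ e = a.hom := by
      rw [← hf, comp_rest, h, b.rest_hom, a.idem_comp]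
    refine ⟨⟨a.hom, a.rest_hom, ha⟩, LocObj.hom_ext ?_, LocObj.hom_ext h⟩
    rw [LocObj.comp_hom, hme]
    exact ha
  · rintro ⟨h, rfl, rfl⟩
    rw [LocObj.comp_hom, LocObj.comp_hom, hme, h.comp_idem]

/-- Evaluating at the generic element, defined on `(A, rest f)`, gives `rest f ≫ g = f`; by symmetry
`f` and `g` restrict to each other. -/
theorem unitHom_injective {A B : X} {f g : A ⟶ B} (h : unitHom f = unitHom g) : f = g := by
  have key : ∀ {f g : A ⟶ B}, unitHom f = unitHom g → rest f ≫ g = f := by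
    intro f g h
    have h1 : (unitHom f).rel ⟨A, rest f, rest_rest f⟩ ⟨rest f, rest_rest f, Category.comp_id _⟩
        ⟨f, rfl, Category.comp_id _⟩ := rest_comp_self f
    rw [h] at h1
    exact h1
  have h1 := key h
  have h2 := key h.symm
  have h3 : rest f = rest g := by
    have h1' := congrArg rest h1
    have h2' := congrArg rest h2
    rw [← rest_rest_comp] at h1' h2'
    rw [← h1', rest_comm, h2']
  rw [← h1, h3, rest_comp_self]

variable (X) in
/-- The comparison of a restriction category with the restriction category of its local
category. -/
def unitFunctor : RestrictionFunctor X (RelObj (LocObj X)) where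
  toFunctor :=
    { obj := unitObj
      map := unitHom
      map_id := fun A => RelObj.hom_ext fun W a b => by
        rw [unitHom_rel, Category.comp_id, RelObj.id_rel]
        exact LocObj.hom_ext_iff.symm
      map_comp := fun {A B D} f g => RelObj.hom_ext fun W a c => by
        rw [unitHom_rel, RelObj.comp_rel]
        constructor
        · intro h
          -- The intermediate value must be defined on all of `W`: its domain lies between those of
          -- `a ≫ f ≫ g` and `a`, both equal to `W.idem`.
          have hf : rest (a.hom ≫ f) = W.idem := by
            have h1 := rest_comp_rest_self a.hom f
            have h2 := rest_comp_rest_self (a.hom ≫ f) g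
            rw [a.rest_hom] at h1
            rw [Category.assoc, h, c.rest_hom, ← W.rest_idem, rest_comm, W.rest_idem, h1] at h2
            exact h2
          exact ⟨⟨a.hom ≫ f, hf, Category.comp_id _⟩, rfl, (Category.assoc _ _ _).trans h⟩
        · rintro ⟨b, h, h'⟩
          rw [← h', ← (show a.hom ≫ f = b.hom from h), Category.assoc] }
  map_rest {A B} f := RelObj.hom_ext fun W a a' => by
    rw [unitHom_rel, RelObj.rest_rel]
    constructor
    · intro h
      have hf : rest (a.hom ≫ f) = W.idem := by
        have h1 := rest_comp_rest_self a.hom f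
        rw [comp_rest] at h
        have h2 := congrArg rest h
        rwa [← rest_rest_comp, h1, a'.rest_hom] at h2
      rw [comp_rest, hf, a.idem_comp] at h
      exact ⟨LocObj.hom_ext h, ⟨a.hom ≫ f, hf, Category.comp_id _⟩, rfl⟩
    · rintro ⟨rfl, b, h⟩
      rw [comp_rest, (show a.hom ≫ f = b.hom from h), b.rest_hom, a.idem_comp]

instance : (unitFunctor X).toFunctor.Full := ⟨fun R => exists_unitHom_eq R⟩

instance : (unitFunctor X).toFunctor.Faithful := ⟨fun h => unitHom_injective h⟩

variable (X) in
theorem unitObj_base_eq (A : RelObj (LocObj X)) :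
    (unitFunctor X).toFunctor.obj A.obj.base = A :=
  RelObj.ext A.L_obj

variable (X) in
/-- The inverse of `unitFunctor`. -/
noncomputable def unitInverse : RestrictionFunctor (RelObj (LocObj X)) X where
  toFunctor := sectionFunctor (unitFunctor X).toFunctor (fun A => A.obj.base) (unitObj_base_eq X)
  map_rest f := (unitFunctor X).toFunctor.map_injective (by
    rw [(unitFunctor X).map_rest, map_sectionFunctor_map, map_sectionFunctor_map,
      rest_eqToHom_comp_comp_eqToHom])

theorem unitFunctor_comp_unitInverse :
    (unitFunctor X).comp (unitInverse X) = RestrictionFunctor.id X :=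
  RestrictionFunctor.ext_functor (comp_sectionFunctor _ _ _ fun _ => rfl)

theorem unitInverse_comp_unitFunctor :
    (unitInverse X).comp (unitFunctor X) = RestrictionFunctor.id _ :=
  RestrictionFunctor.ext_functor (sectionFunctor_comp _ _ _)

theorem total_obj_eq (F : RestrictionFunctor X Y) (A : X) :
    LocObj.total (F.toFunctor.obj A) = F.toLocal.toFunctor.obj (LocObj.total A) :=
  LocObj.eq_iff.2 (F.toFunctor.map_id A).symm

theorem comp_eqToHom_total_hom (F : RestrictionFunctor X Y) {A : X} {W : LocObj Y}
    (a : W ⟶ LocObj.total (F.toFunctor.obj A)) :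
    (a ≫ eqToHom (total_obj_eq F A)).hom = a.hom := by
  rw [LocObj.comp_hom, LocObj.eqToHom_hom, ← Category.assoc, a.comp_idem]
  exact Category.comp_id _

/-- Both sides are represented by spans with apex on `F A`, cut out by `rest (F f)` and by `F (rest
f)`; these agree for a restriction functor. -/
theorem comp_unitFunctor (F : RestrictionFunctor X Y) :
    F.comp (unitFunctor Y) = (unitFunctor X).comp F.toLocal.toRestriction := by
  refine RestrictionFunctor.ext_functor (Functor.hext (fun A => RelObj.ext (total_obj_eq F A))
    fun A B f => RelObj.hom_hext (total_obj_eq F A) (total_obj_eq F B) fun W a b => ?_)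
  refine (comp_eq_iff_exists (F.toFunctor.map f) W a b).trans
    (Iff.trans ?_ (F.toLocal.exists_iff_of_span (unitHom f) (comp_eq_iff_exists f) W
      (a ≫ eqToHom (total_obj_eq F A)) (b ≫ eqToHom (total_obj_eq F B))).symm)
  have hF := F.map_rest f
  have ha := comp_eqToHom_total_hom F a
  have hb := comp_eqToHom_total_hom F b
  constructor
  · rintro ⟨h, h1, h2⟩
    exact ⟨⟨h.hom, h.rest_hom, (congrArg (h.hom ≫ ·) hF).trans h.comp_idem⟩,
      LocObj.hom_ext (((congrArg (h.hom ≫ ·) hF).trans (congrArg LocHom.hom h1)).trans ha.symm),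
      LocObj.hom_ext ((congrArg LocHom.hom h2).trans hb.symm)⟩
  · rintro ⟨h, h1, h2⟩
    exact ⟨⟨h.hom, h.rest_hom, (congrArg (h.hom ≫ ·) hF).symm.trans h.comp_idem⟩,
      LocObj.hom_ext (((congrArg (h.hom ≫ ·) hF).symm.trans (congrArg LocHom.hom h1)).trans ha),
      LocObj.hom_ext ((congrArg LocHom.hom h2).trans hb)⟩

theorem whiskerRight_unitFunctor_app_heq {F G : RestrictionFunctor X Y}
    (φ : RestrictionNatTrans F G) (A : X) :
    (φ.whiskerRight (unitFunctor Y)).app A ≍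
      (RestrictionNatTrans.whiskerLeft (unitFunctor X)
        (LocalFunctor.natTransToRestriction φ.toLocal)).app A := by
  refine RelObj.hom_hext (total_obj_eq F A) (total_obj_eq G A) fun W a b => ?_
  have ha := comp_eqToHom_total_hom F a
  have hb := comp_eqToHom_total_hom G b
  have hφ : (NatTrans.app φ.toLocal (LocObj.total A)).hom = φ.app A := by
    rw [RestrictionNatTrans.toLocal_app_hom]
    exact (congrArg (· ≫ φ.app A) (F.toFunctor.map_id A)).trans (Category.id_comp _)
  have hab : ((a ≫ eqToHom (total_obj_eq F A)) ≫ NatTrans.app φ.toLocal (LocObj.total A)).hom =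
      a.hom ≫ φ.app A := congrArg₂ (fun f g => f ≫ g) ha hφ
  exact ⟨fun h => LocObj.hom_ext (hab.trans (Eq.trans h hb.symm)),
    fun h => hab.symm.trans ((congrArg LocHom.hom h).trans hb)⟩

end Unit

/-- The comparison of the identity with the composite of `localFunctor` and
`restrictionFunctor`. -/
def unitTransformation : TwoNatTrans (StrictPseudofunctor.id InvRCatLax.{u})
    (localFunctor.comp restrictionFunctor) where
  app X := InducedBicategory.mkHom (unitFunctor X.1.carrier)
  naturality F := InducedBicategory.Hom.ext (comp_unitFunctor F.hom)
  naturality₂ {_ _ F G} φ := comp_eqToHom_eq_eqToHom_comp _ _ (hom₂_hext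
    (InducedBicategory.Hom.ext (comp_unitFunctor F.hom))
    (InducedBicategory.Hom.ext (comp_unitFunctor G.hom))
    (RestrictionNatTrans.hext (comp_unitFunctor F.hom) (comp_unitFunctor G.hom)
      (whiskerRight_unitFunctor_app_heq φ.hom)))

theorem isOneCellIso_unitTransformation_app (X : InvRCatLax.{u}) :
    IsOneCellIso (unitTransformation.app X) :=
  ⟨InducedBicategory.mkHom (unitInverse X.1.carrier),
    InducedBicategory.Hom.ext unitFunctor_comp_unitInverse,
    InducedBicategory.Hom.ext unitInverse_comp_unitFunctor⟩

open RestrictionStructure LocalStructure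

/-! ### The counit: a local category and its double transform. -/

section Counit

universe v₁ u₁ v₂ u₂

variable {C : Type u₁} [Category.{v₁} C] [LocalStructure C]
  {D : Type u₂} [Category.{v₂} D] [LocalStructure D]

theorem η_eq_eqToHom {A : C} (h : L A = A) : η A = eqToHom h.symm := by
  have key : ∀ {B : C} (hB : L A = B), η B = eqToHom (by rw [← hB, L_L]) := by
    rintro _ rfl
    exact η_L A
  exact key h

/-- The enlargement of an object, as an object of the restriction category. -/
abbrev enlargement (M : C) : RelObj C := ⟨L M, L_L M⟩

/-- A morphism regarded as a partial morphism between the enlargements. -/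
def extendHom {M N : C} (f : M ⟶ N) : enlargement M ⟶ enlargement N where
  rel W a b := ∃ h : W ⟶ M, h ≫ η M = a ∧ h ≫ f ≫ η N = b
  exists_span := ⟨M, η M, f ≫ η N, IsInclusion.η_inclusion M, fun _ _ _ => Iff.rfl⟩

theorem extendHom_rel {M N : C} (f : M ⟶ N) {W : C} {a : W ⟶ L M} {b : W ⟶ L N} :
    (extendHom f).rel W a b ↔ ∃ h : W ⟶ M, h ≫ η M = a ∧ h ≫ f ≫ η N = b := Iff.rfl

theorem extendHom_id_rel {M : C} {W : C} {a b : W ⟶ L M} :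
    (extendHom (𝟙 M)).rel W a b ↔ a = b ∧ ∃ h : W ⟶ M, h ≫ η M = a := by
  rw [extendHom_rel]
  constructor
  · rintro ⟨h, rfl, rfl⟩
    exact ⟨by simp, h, rfl⟩
  · rintro ⟨rfl, h, rfl⟩
    exact ⟨h, rfl, by simp⟩

theorem extendHom_comp {M N K : C} (f : M ⟶ N) (g : N ⟶ K) :
    extendHom (f ≫ g) = extendHom f ≫ extendHom g :=
  RelObj.hom_ext fun W a c => by
    constructor
    · rintro ⟨h, rfl, rfl⟩
      exact ⟨h ≫ f ≫ η N, ⟨h, rfl, rfl⟩, h ≫ f, by simp, by simp⟩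
    · rintro ⟨b, ⟨h, rfl, rfl⟩, k, hk, rfl⟩
      rw [← Category.assoc, cancel_mono] at hk
      subst hk
      exact ⟨h, rfl, by simp⟩

theorem rest_extendHom {M N : C} (f : M ⟶ N) : rest (extendHom f) = extendHom (𝟙 M) :=
  RelObj.hom_ext fun W a b => by
    rw [extendHom_id_rel]
    constructor
    · rintro ⟨rfl, _, h, rfl, rfl⟩
      exact ⟨rfl, h, rfl⟩
    · rintro ⟨rfl, h, rfl⟩
      exact ⟨rfl, _, h, rfl, rfl⟩

theorem extendHom_injective {M N : C} {f g : M ⟶ N} (h : extendHom f = extendHom g) : f = g := by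
  have h1 : (extendHom f).rel M (η M) (f ≫ η N) := ⟨𝟙 M, by simp, by simp⟩
  rw [h] at h1
  obtain ⟨k, hk, hk'⟩ := h1
  obtain rfl : k = 𝟙 M := by rw [← cancel_mono (η M), hk, Category.id_comp]
  rw [Category.id_comp, cancel_mono] at hk'
  exact hk'.symm

/-- The first hypothesis says that `R` is defined exactly on `M`, so it has a value at the generic
element `η M`; the second says that this value factors through `η N`, and the factor is the required
map. -/
theorem exists_extendHom_eq {M N : C} (R : enlargement M ⟶ enlargement N)
    (h1 : rest R = extendHom (𝟙 M)) (h2 : R ≫ extendHom (𝟙 N) = R) :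
    ∃ f : M ⟶ N, extendHom f = R := by
  have h3 : (rest R).rel M (η M) (η M) := by
    rw [h1, extendHom_id_rel]
    exact ⟨rfl, 𝟙 M, Category.id_comp _⟩
  obtain ⟨-, b, hb⟩ := h3
  have h4 : (R ≫ extendHom (𝟙 N)).rel M (η M) b := by
    rwa [h2]
  obtain ⟨c, -, h5⟩ := h4
  obtain ⟨rfl, f, rfl⟩ := extendHom_id_rel.1 h5
  refine ⟨f, RelObj.hom_ext fun W a b => ⟨?_, fun h => ?_⟩⟩
  · rintro ⟨k, rfl, rfl⟩
    exact R.rel_comp hb k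
  · have h6 : (rest R).rel W a a := ⟨rfl, b, h⟩
    rw [h1, extendHom_id_rel] at h6
    obtain ⟨-, k, rfl⟩ := h6
    exact ⟨k, rfl, R.rel_unique (R.rel_comp hb k) h⟩

/-- The comparison on objects. -/
abbrev counitObj (M : C) : LocObj (RelObj C) :=
  ⟨enlargement M, extendHom (𝟙 M), rest_extendHom _⟩

variable (C) in
/-- The comparison of a local category with the local category of its restriction category,
as a functor. -/
def counitBase : C ⥤ LocObj (RelObj C) where
  obj := counitObj
  map {M N} f := ⟨extendHom f, rest_extendHom f, by rw [← extendHom_comp, Category.comp_id]⟩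
  map_id _ := rfl
  map_comp f g := LocObj.hom_ext (extendHom_comp f g)

instance : (counitBase C).Full := ⟨fun f => by
  obtain ⟨g, hg⟩ := exists_extendHom_eq f.hom f.rest_hom f.comp_idem
  exact ⟨g, LocObj.hom_ext hg⟩⟩

instance : (counitBase C).Faithful := ⟨fun h => extendHom_injective (congrArg LocHom.hom h)⟩

/-- A restriction idempotent is a partial diagonal, so it is determined by the elements related to
themselves. -/
theorem RelObj.locObj_ext {M N : LocObj (RelObj C)} (h : M.base.obj = N.base.obj)
    (h' : ∀ (W : C) (a : W ⟶ M.base.obj),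
      M.idem.rel W a a ↔ N.idem.rel W (a ≫ eqToHom h) (a ≫ eqToHom h)) : M = N := by
  have key : ∀ (M : LocObj (RelObj C)) {W : C} {a b : W ⟶ M.base.obj},
      M.idem.rel W a b ↔ a = b ∧ M.idem.rel W a a := fun M W a b => by
    have hM := M.rest_idem
    constructor
    · intro hab
      have hab' := hab
      rw [← hM] at hab'
      obtain ⟨rfl, -⟩ := hab'
      exact ⟨rfl, hab⟩
    · rintro ⟨rfl, ha⟩
      exact ha
  refine LocObj.ext (RelObj.ext h) (RelObj.hom_hext h h fun W a b => ?_)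
  rw [key M, key N, h', cancel_mono]

/-- Both legs of a span representing an idempotent coincide, so its apex `V` is a preimage.
Preimages need not be unique, and the second clause prescribes `Y.base.obj` for identities, so that
the chosen section commutes with `L` on the nose. -/
theorem exists_counitObj_eq (Y : LocObj (RelObj C)) :
    ∃ V : C, counitObj V = Y ∧ (Y.idem = 𝟙 Y.base → V = Y.base.obj) := by
  by_cases hY : Y.idem = 𝟙 Y.base
  · refine ⟨Y.base.obj, RelObj.locObj_ext Y.base.L_obj fun W a => ?_, fun _ => rfl⟩
    rw [hY, RelObj.id_rel, extendHom_id_rel]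
    refine iff_of_true ⟨rfl, a ≫ eqToHom Y.base.L_obj, ?_⟩ rfl
    rw [η_eq_eqToHom Y.base.L_obj, Category.assoc, eqToHom_trans, eqToHom_refl, Category.comp_id]
  · obtain ⟨V, m, f, hm, hR⟩ := Y.idem.exists_span
    obtain ⟨hL, e⟩ := hm
    rw [η_eq_eqToHom Y.base.L_obj] at e
    refine ⟨V, RelObj.locObj_ext (hL.trans Y.base.L_obj) fun W a => ?_, fun h => absurd h hY⟩
    have hmf : m = f := by
      have h1 : Y.idem.rel V m f := (hR _ _ _).2 ⟨𝟙 V, by simp⟩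
      rw [← Y.rest_idem] at h1
      exact h1.1
    subst hmf
    rw [hR, extendHom_id_rel]
    have hm : m = η V ≫ eqToHom (hL.trans Y.base.L_obj) := by
      rw [← eqToHom_trans hL Y.base.L_obj, ← Category.assoc, ← e]
      simp
    rw [hm]
    simp only [← Category.assoc, cancel_mono, true_and, and_self]

/-- An object of a local category that represents an idempotent on an enlargement. -/
noncomputable def splitting (Y : LocObj (RelObj C)) : C := (exists_counitObj_eq Y).choose

theorem counitBase_obj_splitting (Y : LocObj (RelObj C)) :
    (counitBase C).obj (splitting Y) = Y := (exists_counitObj_eq Y).choose_spec.1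

theorem splitting_total (A : RelObj C) : splitting (LocObj.total A) = A.obj :=
  (exists_counitObj_eq (LocObj.total A)).choose_spec.2 rfl

instance : (counitBase C).IsEquivalence := isEquivalence_of_section _ counitBase_obj_splitting

theorem counitObj_L (M : C) : counitObj (L M) = L (counitObj M) := by
  refine RelObj.locObj_ext (L_L M) fun W a => ?_
  rw [extendHom_id_rel]
  refine iff_of_true ⟨rfl, a ≫ eqToHom (L_L M), ?_⟩ ((RelObj.id_rel (enlargement M)).2 rfl)
  rw [η_L, Category.assoc, eqToHom_trans, eqToHom_refl, Category.comp_id]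

theorem counitBase_obj_L (M : C) : (counitBase C).obj (L M) = L ((counitBase C).obj M) :=
  counitObj_L M

theorem extendHom_η_comp_eqToHom (M : C) (h : enlargement (L M) = enlargement M) :
    (extendHom (η M) ≫ extendHom (𝟙 (L M))) ≫ eqToHom h = extendHom (𝟙 M) := by
  rw [← extendHom_comp, Category.comp_id]
  refine RelObj.hom_ext fun W a c => ?_
  rw [RelObj.comp_rel, extendHom_id_rel]
  simp only [RelObj.eqToHom_rel, extendHom_rel, η_L]
  constructor
  · rintro ⟨_, ⟨h, rfl, rfl⟩, rfl⟩
    exact ⟨by simp, h, rfl⟩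
  · rintro ⟨rfl, h, rfl⟩
    exact ⟨_, ⟨h, rfl, rfl⟩, by simp⟩

theorem counitBase_map_η_comp (M : C) :
    (counitBase C).map (η M) ≫ eqToHom (counitBase_obj_L M) = η ((counitBase C).obj M) :=
  LocObj.hom_ext (by
    rw [LocObj.comp_hom, LocObj.eqToHom_hom, ← Category.assoc]
    exact extendHom_η_comp_eqToHom M _)

variable (C) in
/-- The comparison of a local category with the local category of its restriction category. -/
def counitFunctor : LocalFunctor C (LocObj (RelObj C)) where
  toFunctor := counitBase C
  obj_L := counitBase_obj_L
  map_η := counitBase_map_η_comp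
  map_isPullback _ _ _ h := h.map _

theorem RelObj.idem_rel_of_eq {Y Z : LocObj (RelObj C)} (h : Y = Z) {W : C}
    {a b : W ⟶ Y.base.obj} (hab : Y.idem.rel W a b) :
    Z.idem.rel W (a ≫ eqToHom (congrArg (fun Y => Y.base.obj) h))
      (b ≫ eqToHom (congrArg (fun Y => Y.base.obj) h)) := by
  subst h
  simpa using hab

theorem η_eq_of_eq {M N : C} (h : M = N) :
    η M = eqToHom h ≫ η N ≫ eqToHom (congrArg L h.symm) := by
  subst h
  simp

theorem counitBase_map_η (M : C) : (counitBase C).map (η M) =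
    η ((counitBase C).obj M) ≫ eqToHom (counitBase_obj_L M).symm := by
  rw [← counitBase_map_η_comp, Category.assoc, eqToHom_trans, eqToHom_refl, Category.comp_id]

/-- The generic element `η M` is fixed by the idempotent of `M`, hence by that of `N`, and so
factors through `η N`. -/
theorem below_of_counitObj_eq {M N : C} (h : counitObj M = counitObj N) : Below M N := by
  have hL : L M = L N := congrArg (fun Y => Y.base.obj) h
  have h1 : (counitObj M).idem.rel M (η M) (η M) :=
    extendHom_id_rel.2 ⟨rfl, 𝟙 M, Category.id_comp _⟩
  obtain ⟨-, m, hm⟩ := extendHom_id_rel.1 (RelObj.idem_rel_of_eq h h1)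
  exact ⟨m, hL, hm⟩

variable (C) in
/-- The functor underlying `counitInverse`. -/
noncomputable def counitInverseBase : LocObj (RelObj C) ⥤ C :=
  sectionFunctor (counitBase C) splitting counitBase_obj_splitting

theorem counitBase_obj_counitInverseBase_obj (Y : LocObj (RelObj C)) :
    (counitBase C).obj ((counitInverseBase C).obj Y) = Y := counitBase_obj_splitting Y

theorem counitBase_map_counitInverseBase_map {Y Z : LocObj (RelObj C)} (f : Y ⟶ Z) :
    (counitBase C).map ((counitInverseBase C).map f) =
      eqToHom (counitBase_obj_counitInverseBase_obj Y) ≫ f ≫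
        eqToHom (counitBase_obj_counitInverseBase_obj Z).symm :=
  map_sectionFunctor_map _ _ _ f

theorem counitInverseBase_obj_L (Y : LocObj (RelObj C)) :
    (counitInverseBase C).obj (L Y) = L ((counitInverseBase C).obj Y) :=
  -- Both sides equal `Y.base.obj`: the left by the prescribed choice for identity idempotents, the
  -- right because the splitting maps back to `Y`.
  (splitting_total Y.base).trans
    (congrArg (fun Y => Y.base.obj) (counitBase_obj_splitting Y)).symm

variable (C) in
/-- The inverse of `counitFunctor` up to isomorphism. -/
noncomputable def counitInverse : LocalFunctor (LocObj (RelObj C)) C where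
  toFunctor := counitInverseBase C
  obj_L := counitInverseBase_obj_L
  map_η Y := (counitBase C).map_injective (by
    rw [(counitBase C).map_comp, counitBase_map_counitInverseBase_map, eqToHom_map,
      counitBase_map_η, η_eq_of_eq (counitBase_obj_counitInverseBase_obj Y)]
    simp)
  map_isPullback _ _ _ h := by
    have : (counitInverseBase C).IsEquivalence :=
      isEquivalence_sectionFunctor (counitBase C) splitting counitBase_obj_splitting
    exact h.map _

/-- The span with legs `η M` and `f ≫ η N` is carried by `F` to the span defining the extension of
`F f`, since `F` preserves the maximal inclusions. -/
theorem extendHom_map_rel_iff (F : LocalFunctor C D) {M N : C} (f : M ⟶ N) (W : D)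
    (x : W ⟶ L (F.toFunctor.obj M)) (y : W ⟶ L (F.toFunctor.obj N)) :
    (extendHom (F.toFunctor.map f)).rel W x y ↔
      (F.mapHom (extendHom f)).rel W (x ≫ eqToHom (F.obj_L M).symm)
        (y ≫ eqToHom (F.obj_L N).symm) := by
  refine Iff.trans ?_ (F.exists_iff_of_span (extendHom f) (m := η M) (f := f ≫ η N)
    (fun _ _ _ => Iff.rfl) W _ _).symm
  rw [extendHom_rel, ← F.map_η, ← F.map_η, F.toFunctor.map_comp]
  refine exists_congr fun h => and_congr ?_ ?_
  · rw [← cancel_mono (eqToHom (F.obj_L M).symm)]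
    simp
  · rw [← cancel_mono (eqToHom (F.obj_L N).symm)]
    simp

theorem counitObj_obj (F : LocalFunctor C D) (M : C) :
    counitObj (F.toFunctor.obj M) = F.toRestriction.toLocal.toFunctor.obj (counitObj M) := by
  refine RelObj.locObj_ext (F.obj_L M).symm fun W x => ?_
  have h := extendHom_map_rel_iff F (𝟙 M) W x x
  rw [F.toFunctor.map_id] at h
  exact h

theorem comp_counitFunctor (F : LocalFunctor C D) :
    F.comp (counitFunctor D) = (counitFunctor C).comp F.toRestriction.toLocal :=
  LocalFunctor.ext_functor (Functor.hext (counitObj_obj F) fun M N f =>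
    LocObj.hom_hext (counitObj_obj F M) (counitObj_obj F N)
      (RelObj.hom_hext (F.obj_L M).symm (F.obj_L N).symm (extendHom_map_rel_iff F f)))

/-- The right side is the graph of `φ` at `L M` restricted to `M`; naturality of `φ` at `η M`
identifies it with the extension of `φ` at `M`. -/
theorem whiskerRight_counitFunctor_app_heq {F G : LocalFunctor C D}
    (φ : F.toFunctor ⟶ G.toFunctor) (M : C) :
    (counitBase D).map (φ.app M) ≍
      NatTrans.app (LocalFunctor.natTransToRestriction φ).toLocal (counitObj M) := by
  refine LocObj.hom_hext (counitObj_obj F M) (counitObj_obj G M)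
    (RelObj.hom_hext (F.obj_L M).symm (G.obj_L M).symm fun W x y => ?_)
  have hspan := F.exists_iff_of_span (extendHom (𝟙 M)) (m := η M) (f := 𝟙 M ≫ η M)
    (fun _ _ _ => Iff.rfl) W
  have hF : ∀ h : W ⟶ F.toFunctor.obj M, h ≫ η (F.toFunctor.obj M) = x ↔
      h ≫ F.toFunctor.map (η M) = x ≫ eqToHom (F.obj_L M).symm := fun h => by
    rw [← cancel_mono (eqToHom (F.obj_L M).symm), ← F.map_η]
    simp
  have hG : ∀ h : W ⟶ G.toFunctor.obj M, h ≫ η (G.toFunctor.obj M) = y ↔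
      h ≫ G.toFunctor.map (η M) = y ≫ eqToHom (G.obj_L M).symm := fun h => by
    rw [← cancel_mono (eqToHom (G.obj_L M).symm), ← G.map_η]
    simp
  have hφ : ∀ h : W ⟶ F.toFunctor.obj M, (h ≫ φ.app M) ≫ G.toFunctor.map (η M) =
      (h ≫ F.toFunctor.map (η M)) ≫ φ.app (L M) := fun h => by simp
  constructor
  · rintro ⟨h, h1, h2⟩
    rw [← Category.assoc, hG, hφ] at h2
    rw [hF] at h1
    exact ⟨_, (hspan _ _).2 ⟨h, h1, by rw [Category.id_comp]⟩, h2⟩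
  · rintro ⟨z, hz, hz'⟩
    obtain ⟨h, h1, rfl⟩ := (hspan _ _).1 hz
    refine ⟨h, (hF h).2 h1, ?_⟩
    rw [Category.id_comp] at hz'
    exact (Category.assoc _ _ _).symm.trans ((hG _).2 ((hφ h).trans hz'))

theorem counitFunctor_comp_counitInverse
    (hC : ∀ M N : C, Below M N → Below N M → M = N) :
    (counitFunctor C).comp (counitInverse C) = LocalFunctor.id C :=
  LocalFunctor.ext_functor (comp_sectionFunctor (counitBase C) _ counitBase_obj_splitting fun _ =>
    hC _ _ (below_of_counitObj_eq (counitBase_obj_splitting _))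
      (below_of_counitObj_eq (counitBase_obj_splitting _).symm))

theorem counitInverse_comp_counitFunctor :
    (counitInverse C).comp (counitFunctor C) = LocalFunctor.id _ :=
  LocalFunctor.ext_functor (sectionFunctor_comp (counitBase C) _ counitBase_obj_splitting)

variable (C) in
/-- `counitInverse` is an inverse of `counitFunctor` up to isomorphism. -/
noncomputable def counitFunctorCompCounitInverseIso :
    (counitFunctor C).comp (counitInverse C) ≅ LocalFunctor.id C :=
  let e := compSectionFunctorIso (counitBase C) splitting counitBase_obj_splitting
  ⟨e.hom, e.inv, e.hom_inv_id, e.inv_hom_id⟩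

theorem IsLocalIso.exists_factorization {A B : C} {f : A ⟶ B} (hf : IsLocalIso f) :
    ∃ (V : C) (g : A ≅ V) (m : V ⟶ B), IsInclusion m ∧
      (∀ m' : V ⟶ B, IsInclusion m' → m' = m) ∧ g.hom ≫ m = f := by
  obtain ⟨V, g, m, hm, hg, h⟩ := hf
  exact ⟨V, asIso g, m, hm, fun _ hm' => hm'.eq hm, h⟩

end Counit

/-- The comparison of the identity with the composite of `restrictionFunctor` and
`localFunctor`. -/
def counitTransformation : TwoNatTrans (StrictPseudofunctor.id InvLCatLax.{u})
    (restrictionFunctor.comp localFunctor) where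
  app C := InducedBicategory.mkHom (counitFunctor C.1.carrier)
  naturality F := InducedBicategory.Hom.ext (comp_counitFunctor F.hom)
  naturality₂ {_ _ F G} φ := comp_eqToHom_eq_eqToHom_comp _ _ (hom₂_hext
    (InducedBicategory.Hom.ext (comp_counitFunctor F.hom))
    (InducedBicategory.Hom.ext (comp_counitFunctor G.hom))
    (LocalFunctor.natTrans_hext (comp_counitFunctor F.hom) (comp_counitFunctor G.hom)
      (whiskerRight_counitFunctor_app_heq φ.hom)))

theorem isOneCellEquivalence_counitTransformation_app (C : InvLCatLax.{u}) :
    IsOneCellEquivalence (counitTransformation.app C) :=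
  ⟨InducedBicategory.mkHom (counitInverse C.1.carrier),
    ⟨InducedBicategory.isoMk (counitFunctorCompCounitInverseIso C.1.carrier)⟩,
    ⟨eqToIso (InducedBicategory.Hom.ext counitInverse_comp_counitFunctor)⟩⟩

theorem isOneCellIso_counitTransformation_app {C : InvLCatLax.{u}} (hC : C.1.IsAntisymm) :
    IsOneCellIso (counitTransformation.app C) :=
  ⟨InducedBicategory.mkHom (counitInverse C.1.carrier),
    InducedBicategory.Hom.ext (counitFunctor_comp_counitInverse hC),
    InducedBicategory.Hom.ext counitInverse_comp_counitFunctor⟩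

theorem IsOneCellIso.isOneCellEquivalence {K : Type*} [Bicategory K] {X Y : K} {f : X ⟶ Y}
    (hf : IsOneCellIso f) : IsOneCellEquivalence f :=
  let ⟨g, h, h'⟩ := hf
  ⟨g, ⟨eqToIso h⟩, ⟨eqToIso h'⟩⟩

/-- The 2-equivalence between inverse restriction categories and inverse local categories. -/
def twoEquivalence : TwoEquivalence InvRCatLax.{u} InvLCatLax.{u} where
  functor := localFunctor
  inverse := restrictionFunctor
  unit := unitTransformation
  counit := counitTransformation
  unit_equivalence X := (isOneCellIso_unitTransformation_app X).isOneCellEquivalence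
  counit_equivalence := isOneCellEquivalence_counitTransformation_app

end Partiality

theorem mainTheorem8 :
    (∃ E : Partiality.TwoEquivalence Partiality.InvRCatLax.{u} Partiality.InvLCatLax.{u},
      (∀ X : Partiality.InvRCatLax.{u}, Partiality.IsOneCellIso (E.unit.app X)) ∧
      (∀ X : Partiality.InvRCatLax.{u}, (E.functor.obj X).1.IsAntisymm) ∧
      (∀ C : Partiality.InvLCatLax.{u}, C.1.IsAntisymm →
        Partiality.IsOneCellIso (E.counit.app C))) ∧
    (∀ C : Partiality.LCatLax.{u}, C.IsInverse → ∀ {A B : C.carrier} (f : A ⟶ B),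
      ∃ (V : C.carrier) (g : A ≅ V) (m : V ⟶ B), Partiality.IsInclusion m ∧
        (∀ m' : V ⟶ B, Partiality.IsInclusion m' → m' = m) ∧ g.hom ≫ m = f) :=
  ⟨⟨Partiality.twoEquivalence, Partiality.isOneCellIso_unitTransformation_app,
    fun X => Partiality.RCatLax.isAntisymm_toLCatLax X.1,
    fun _ hC => Partiality.isOneCellIso_counitTransformation_app hC⟩,
    fun _ hC _ _ f => (hC f).exists_factorization⟩
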